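/- Let $\mathcal H$ be a real separable Hilbert space with complexification $\mathcal H^{\mathbb C}$, let $\mathcal L(\cdot)$ and $\mathcal L_1(\cdot)$ denote bounded and trace-class operators, and let $x\otimes y=\langle\cdot,y\rangle x$. Let $p,q\in\mathbb N_0$, $d\in(-1/2,1/2)$, let $\mathcal A_1,\dots,\mathcal A_p,\mathcal B_1,\dots,\mathcal B_q\in\mathcal L(\mathcal H)$, and let $(\epsilon_t)_{t\in\mathbb Z}$ be i.i.d. mean-zero random elements of $\mathcal H$ with $\mathbb E\|\epsilon_0\|^2<\infty$ and covariance operator $\mathcal S=\mathbb E[\epsilon_0\otimes\epsilon_0]$. Assume that some power $\tilde{\mathcal A}^{j_0}$, $j_0\in\mathbb N$, of the companion operator $\tilde{\mathcal A}(x_1,\dots,x_p)=(\mathcal A_1x_1+\dots+\mathcal A_px_p,\,x_1,\dots,x_{p-1})$ on $\mathcal H^p$ has operator norm less than $1$. Let $\tilde X=(\tilde X_t)_{t\in\mathbb Z}$ be the FARFIMA$(p,d,q)$ process, that is, the mean-zero process with finite second moments, causal with respect to $(\epsilon_t)$, such that $$(\mathrm{Id}-\Delta)^d\tilde X_t=X_t,\qquad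 X_t=\sum_{j=1}^p\mathcal A_jX_{t-j}+\epsilon_t+\sum_{j=1}^q\mathcal B_j\epsilon_{t-j},\qquad t\in\mathbb Z,$$ where $X$ is the (mean-zero, causal, finite second moment) FARMA$(p,q)$ process, $\Delta$ is the backshift operator, and $(\mathrm{Id}-\Delta)^d=\sum_{k\ge0}(-1)^k\binom dk\Delta^k$, the series converging in mean square. Put $\mathscr A(z)=\mathrm{Id}-\mathcal A_1z-\dots-\mathcal A_pz^p$ and $\mathscr B(z)=\mathrm{Id}+\mathcal B_1z+\dots+\mathcal B_qz^q$. Then $\mathscr A(e^{-i\omega})$ is invertible in $\mathcal L(\mathcal H^{\mathbb C})$ for every real $\omega$, and $\tilde X$ admits a weak spectral density operator $\mathscr F^{\tilde X}\in L^1([0,2\pi],\mathcal L_1(\mathcal H^{\mathbb C}))$ satisfying, for $\omega\in(0,2\pi)$, $$\mathscr F^{\tilde X}_\omega=\frac1{2\pi}\Big[2\sin\Big(\frac\omega2\Big)\Big]^{-2d}\mathscr A(e^{-i\omega})^{-1}\mathscr B(e^{-i\omega})\,\mathcal S\,\mathscr B(e^{-i\omega})^*\big[\mathscr A(e^{-i\omega})^*\big]^{-1}.$$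 The process $\tilde X$ is second-order stationary, and its lag-$h$ autocovariance operators satisfy $$\mathscr R^{\tilde X}_h=\mathbb E[\tilde X_{t+h}\otimes\tilde X_t]=\int_0^{2\pi}\mathscr F^{\tilde X}_\omega e^{ih\omega}\,d\omega,\qquad h,t\in\mathbb Z.$$ -/

import Mathlib

open MeasureTheory ProbabilityTheory Filter Topology
open scoped ENNReal InnerProductSpace

set_option linter.unusedSectionVars false

noncomputable section

namespace FTS

/-! ### The complexification of a real Hilbert space -/

section Complexification

/-- The complexification of a real inner product space `H`: pairs `(x, y)`, thought of as
`x + i y`, with `‖(x, y)‖² = ‖x‖² + ‖y‖²`. -/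
def Complexification (H : Type*) : Type _ := WithLp 2 (H × H)

namespace Complexification

variable {H : Type*} [NormedAddCommGroup H] [InnerProductSpace ℝ H]

instance : NormedAddCommGroup (Complexification H) :=
  inferInstanceAs (NormedAddCommGroup (WithLp 2 (H × H)))

instance [CompleteSpace H] : CompleteSpace (Complexification H) :=
  inferInstanceAs (CompleteSpace (WithLp 2 (H × H)))

/-- The vector `x + i y`. -/
def mk (x y : H) : Complexification H := WithLp.toLp 2 (x, y)

/-- The real part of a vector. -/
def re (z : Complexification H) : H := (WithLp.ofLp z).1

/-- The imaginary part of a vector. -/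
def im (z : Complexification H) : H := (WithLp.ofLp z).2

@[simp] theorem re_mk (x y : H) : (mk x y).re = x := rfl
@[simp] theorem im_mk (x y : H) : (mk x y).im = y := rfl
@[simp] theorem re_zero : (0 : Complexification H).re = 0 := rfl
@[simp] theorem im_zero : (0 : Complexification H).im = 0 := rfl
@[simp] theorem re_add (z w : Complexification H) : (z + w).re = z.re + w.re := rfl
@[simp] theorem im_add (z w : Complexification H) : (z + w).im = z.im + w.im := rfl

@[ext] theorem ext {z w : Complexification H} (h1 : z.re = w.re) (h2 : z.im = w.im) : z = w :=
  (WithLp.ofLp_injective 2) (Prod.ext h1 h2)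

theorem norm_sq (z : Complexification H) : ‖z‖ ^ 2 = ‖z.re‖ ^ 2 + ‖z.im‖ ^ 2 :=
  WithLp.prod_norm_sq_eq_of_L2 (α := H) (β := H) z

/-- `(a + i b)(x + i y) = (a x - b y) + i (a y + b x)`. -/
instance : SMul ℂ (Complexification H) :=
  ⟨fun c z => mk (c.re • z.re - c.im • z.im) (c.re • z.im + c.im • z.re)⟩

@[simp] theorem re_smul (c : ℂ) (z : Complexification H) :
    (c • z).re = c.re • z.re - c.im • z.im := rfl
@[simp] theorem im_smul (c : ℂ) (z : Complexification H) :
    (c • z).im = c.re • z.im + c.im • z.re := rfl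

instance : Module ℂ (Complexification H) where
  one_smul z := by ext <;> simp
  mul_smul c d z := by
    ext <;> simp only [re_smul, im_smul, Complex.mul_re, Complex.mul_im] <;> module
  smul_zero c := by ext <;> simp
  smul_add c z w := by
    ext <;> simp only [re_smul, im_smul, re_add, im_add] <;> module
  add_smul c d z := by
    ext <;> simp only [re_smul, im_smul, re_add, im_add, Complex.add_re, Complex.add_im] <;> module
  zero_smul z := by ext <;> simp

theorem norm_smul_eq (c : ℂ) (z : Complexification H) : ‖c • z‖ = ‖c‖ * ‖z‖ := by
  have h : ‖c • z‖ ^ 2 = (‖c‖ * ‖z‖) ^ 2 := by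
    rw [mul_pow, norm_sq, norm_sq, re_smul, im_smul, ← Complex.normSq_eq_norm_sq,
      Complex.normSq_apply, norm_sub_sq_real, norm_add_sq_real]
    simp only [norm_smul, inner_smul_left, inner_smul_right, mul_pow, Real.norm_eq_abs, sq_abs,
      real_inner_comm z.re z.im]
    simp only [conj_trivial]
    ring
  exact (pow_left_inj₀ (norm_nonneg _) (by positivity) two_ne_zero).1 h

/-- The sesquilinear extension of the inner product of `H`, conjugate-linear in the first
argument as always in Mathlib. -/
instance : InnerProductSpace ℂ (Complexification H) where
  norm_smul_le c z := (norm_smul_eq c z).le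
  inner z w := ⟨inner ℝ z.re w.re + inner ℝ z.im w.im, inner ℝ z.re w.im - inner ℝ z.im w.re⟩
  norm_sq_eq_re_inner z := by
    rw [norm_sq]; simp
  conj_inner_symm z w := by
    apply Complex.ext
    · simp [real_inner_comm]
    · simp [real_inner_comm]
  add_left z w v := by
    apply Complex.ext <;> simp [inner_add_left] <;> ring
  smul_left z w c := by
    apply Complex.ext <;>
      simp [inner_sub_left, inner_add_left, inner_smul_left] <;> ring

/-- The complex-linear extension `x + i y ↦ T x + i T y` of a bounded operator `T`. -/
def map (T : H →L[ℝ] H) : Complexification H →L[ℂ] Complexification H :=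
  LinearMap.mkContinuous
    { toFun := fun z => mk (T z.re) (T z.im)
      map_add' := fun z w => by ext <;> simp
      map_smul' := fun c z => by ext <;> simp } ‖T‖ (fun z => by
    refine (sq_le_sq₀ (norm_nonneg _) (by positivity)).1 ?_
    change ‖mk (T z.re) (T z.im)‖ ^ 2 ≤ _
    rw [mul_pow, norm_sq, norm_sq, mul_add, re_mk, im_mk, ← mul_pow, ← mul_pow]
    gcongr <;> exact T.le_opNorm _)

@[simp] theorem map_apply (T : H →L[ℝ] H) (z : Complexification H) :
    map T z = mk (T z.re) (T z.im) := rfl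

end Complexification

end Complexification

/-! ### Trace-class operators -/

section TraceClass

variable {E : Type*} [NormedAddCommGroup E] [InnerProductSpace ℂ E]

/-- The trace norm `‖T‖₁ = sup ∑ i, |⟨f i, T (e i)⟩|`, the supremum being over all finite
orthonormal families `e`, `f` of the same length; it is `∞` if `T` is not of trace class. -/
def traceNorm (T : E →L[ℂ] E) : ℝ≥0∞ :=
  ⨆ (n : ℕ) (e : Fin n → E) (f : Fin n → E) (_ : Orthonormal ℂ e) (_ : Orthonormal ℂ f),
    ∑ i, ‖inner ℂ (f i) (T (e i))‖ₑ

theorem sum_le_traceNorm (T : E →L[ℂ] E) {n : ℕ} {e f : Fin n → E} (he : Orthonormal ℂ e)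
    (hf : Orthonormal ℂ f) : ∑ i, ‖inner ℂ (f i) (T (e i))‖ₑ ≤ traceNorm T :=
  le_iSup_of_le n <| le_iSup_of_le e <| le_iSup_of_le f <| le_iSup_of_le he <|
    le_iSup_of_le hf le_rfl

theorem traceNorm_le {T : E →L[ℂ] E} {C : ℝ≥0∞}
    (h : ∀ (n : ℕ) (e f : Fin n → E), Orthonormal ℂ e → Orthonormal ℂ f →
      ∑ i, ‖inner ℂ (f i) (T (e i))‖ₑ ≤ C) : traceNorm T ≤ C :=
  iSup_le fun n => iSup_le fun e => iSup_le fun f => iSup_le fun he => iSup_le fun hf =>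
    h n e f he hf

theorem traceNorm_zero : traceNorm (0 : E →L[ℂ] E) = 0 :=
  le_antisymm (traceNorm_le fun n e f _ _ => by simp) zero_le

theorem traceNorm_add_le (S T : E →L[ℂ] E) : traceNorm (S + T) ≤ traceNorm S + traceNorm T := by
  refine traceNorm_le fun n e f he hf => ?_
  refine le_trans ?_ (add_le_add (sum_le_traceNorm S he hf) (sum_le_traceNorm T he hf))
  rw [← Finset.sum_add_distrib]
  refine Finset.sum_le_sum fun i _ => ?_
  rw [add_apply, inner_add_right]
  exact enorm_add_le _ _

theorem traceNorm_smul_le (c : ℂ) (T : E →L[ℂ] E) :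
    traceNorm (c • T) ≤ ‖c‖ₑ * traceNorm T := by
  refine traceNorm_le fun n e f he hf => ?_
  refine le_trans (le_of_eq ?_) (mul_le_mul_right (sum_le_traceNorm T he hf) _)
  rw [Finset.mul_sum]
  refine Finset.sum_congr rfl fun i _ => ?_
  rw [smul_apply, inner_smul_right, enorm_mul]

theorem traceNorm_smul (c : ℂ) (T : E →L[ℂ] E) : traceNorm (c • T) = ‖c‖ₑ * traceNorm T := by
  refine le_antisymm (traceNorm_smul_le c T) ?_
  by_cases hc : c = 0
  · simp [hc]
  have h := traceNorm_smul_le c⁻¹ (c • T)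
  rw [smul_smul, inv_mul_cancel₀ hc, one_smul] at h
  calc ‖c‖ₑ * traceNorm T ≤ ‖c‖ₑ * (‖c⁻¹‖ₑ * traceNorm (c • T)) := by gcongr
    _ = traceNorm (c • T) := by
      rw [← mul_assoc, ← enorm_mul, mul_inv_cancel₀ hc, enorm_one, one_mul]

theorem enorm_inner_le_traceNorm (T : E →L[ℂ] E) {x y : E} (hx : ‖x‖ = 1) (hy : ‖y‖ = 1) :
    ‖inner ℂ y (T x)‖ₑ ≤ traceNorm T := by
  have h := sum_le_traceNorm T (n := 1) (e := fun _ => x) (f := fun _ => y)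
    ⟨fun _ => hx, fun i j hij => (hij (Subsingleton.elim i j)).elim⟩
    ⟨fun _ => hy, fun i j hij => (hij (Subsingleton.elim i j)).elim⟩
  simpa using h

theorem enorm_le_traceNorm (T : E →L[ℂ] E) : ‖T‖ₑ ≤ traceNorm T := by
  by_cases htop : traceNorm T = ∞
  · simp [htop]
  rw [← ofReal_norm]
  refine ENNReal.ofReal_le_of_le_toReal ?_
  refine ContinuousLinearMap.opNorm_le_of_unit_norm ENNReal.toReal_nonneg fun x hx => ?_
  by_cases h0 : T x = 0
  · simp [h0]
  have hn : ‖T x‖ ≠ 0 := norm_ne_zero_iff.2 h0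
  have hy : ‖((‖T x‖⁻¹ : ℝ) : ℂ) • T x‖ = 1 := by
    rw [norm_smul, Complex.norm_real, Real.norm_eq_abs, abs_of_nonneg (by positivity),
      inv_mul_cancel₀ hn]
  have h := ENNReal.toReal_mono htop (enorm_inner_le_traceNorm T hx hy)
  rw [toReal_enorm, inner_smul_left, norm_mul, inner_self_eq_norm_sq_to_K] at h
  simp only [RCLike.norm_conj, Complex.norm_real, norm_inv, norm_norm, norm_pow,
    Complex.coe_algebraMap] at h
  have h2 : ‖T x‖⁻¹ * ‖T x‖ ^ 2 = ‖T x‖ := by field_simp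
  rwa [h2] at h

variable (E) in
/-- The subspace of trace-class operators. -/
def traceClassSubmodule : Submodule ℂ (E →L[ℂ] E) where
  carrier := {T | traceNorm T < ∞}
  zero_mem' := by simp [traceNorm_zero]
  add_mem' := fun {S T} hS hT =>
    lt_of_le_of_lt (traceNorm_add_le S T) (ENNReal.add_lt_top.2 ⟨hS, hT⟩)
  smul_mem' := fun c T hT =>
    lt_of_le_of_lt (traceNorm_smul_le c T) (ENNReal.mul_lt_top enorm_lt_top hT)

variable (E) in
/-- The space `𝓛₁(E)` of trace-class operators, normed by the trace norm. -/
def TraceClass : Type _ := traceClassSubmodule E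

namespace TraceClass

instance : AddCommGroup (TraceClass E) := inferInstanceAs (AddCommGroup (traceClassSubmodule E))
instance : Module ℂ (TraceClass E) := inferInstanceAs (Module ℂ (traceClassSubmodule E))

/-- A trace-class operator as a bounded operator. -/
def toCLM (T : TraceClass E) : E →L[ℂ] E := Subtype.val T

instance : Norm (TraceClass E) := ⟨fun T => (traceNorm T.toCLM).toReal⟩

theorem norm_def (T : TraceClass E) : ‖T‖ = (traceNorm T.toCLM).toReal := rfl

theorem traceNorm_ne_top (T : TraceClass E) : traceNorm T.toCLM ≠ ∞ :=
  ne_of_lt (Subtype.prop T)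

theorem normedSpaceCore : NormedSpace.Core ℂ (TraceClass E) where
  norm_nonneg _ := ENNReal.toReal_nonneg
  norm_smul c T := by
    change (traceNorm (c • T.toCLM)).toReal = ‖c‖ * (traceNorm T.toCLM).toReal
    rw [traceNorm_smul, ENNReal.toReal_mul, toReal_enorm]
  norm_triangle S T := by
    change (traceNorm (S.toCLM + T.toCLM)).toReal ≤ _
    rw [norm_def, norm_def, ← ENNReal.toReal_add S.traceNorm_ne_top T.traceNorm_ne_top]
    exact ENNReal.toReal_mono (ENNReal.add_ne_top.2 ⟨S.traceNorm_ne_top, T.traceNorm_ne_top⟩)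
      (traceNorm_add_le _ _)
  norm_eq_zero_iff T := by
    constructor
    · intro h
      rw [norm_def, ENNReal.toReal_eq_zero_iff] at h
      have h0 := h.resolve_right T.traceNorm_ne_top
      have h1 := enorm_le_traceNorm T.toCLM
      rw [h0, ← ofReal_norm, nonpos_iff_eq_zero, ENNReal.ofReal_eq_zero] at h1
      exact Subtype.ext (norm_le_zero_iff.1 h1)
    · rintro rfl
      change (traceNorm (0 : E →L[ℂ] E)).toReal = 0
      rw [traceNorm_zero, ENNReal.toReal_zero]

instance : NormedAddCommGroup (TraceClass E) := NormedAddCommGroup.ofCore normedSpaceCore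
instance : NormedSpace ℂ (TraceClass E) where
  norm_smul_le c T := (normedSpaceCore.norm_smul c T).le

end TraceClass

end TraceClass

/-! ### Second-order structure of functional time series -/

section TimeSeries

variable {Ω : Type*} [MeasurableSpace Ω] {H : Type*} [NormedAddCommGroup H]
  [InnerProductSpace ℝ H]

/-- The cross-covariance operator `𝔼[(Y - 𝔼 Y) ⊗ (Z - 𝔼 Z)]`, where `x ⊗ y = ⟨·, y⟩ x`. -/
def crossCov (P : Measure Ω) (Y Z : Ω → H) : H →L[ℝ] H :=
  ∫ ω, InnerProductSpace.rankOne ℝ (Y ω - ∫ ω', Y ω' ∂P) (Z ω - ∫ ω', Z ω' ∂P) ∂P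

/-- `F` is a weak spectral density operator of the time series `X`: it is an element of
`L¹([0, 2π], 𝓛₁(H^ℂ))` and the inversion formula holds, the integral being a Bochner integral in
`𝓛(H^ℂ)`. The formula is required of `Cov(X (t + h), X t)` for all `t`, so that it contains the
second-order stationarity of `X`. -/
structure IsWeakSpectralDensity (P : Measure Ω) (X : ℤ → Ω → H)
    (F : ℝ → TraceClass (Complexification H)) : Prop where
  memLp : MemLp F 1 (volume.restrict (Set.Icc 0 (2 * Real.pi)))
  inversion : ∀ t h : ℤ, Complexification.map (crossCov P (X (t + h)) (X t)) =
    ∫ ω in (0 : ℝ)..(2 * Real.pi), Complex.exp (Complex.I * h * ω) • (F ω).toCLM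

/-! ### FARMA and FARFIMA processes -/

/-- The companion operator on `H^p` (with its Hilbert norm): the first component of its value at
`(x₁, …, x_p)` is `A₁ x₁ + ⋯ + A_p x_p`, and the `i`-th component is `x_{i-1}` for `i ≥ 2`.
The operator `A_{j+1}` is `A j`. -/
def companion {p : ℕ} (A : Fin p → H →L[ℝ] H) :
    PiLp 2 (fun _ : Fin p => H) →L[ℝ] PiLp 2 (fun _ : Fin p => H) :=
  (PiLp.continuousLinearEquiv 2 ℝ (fun _ : Fin p => H)).symm.toContinuousLinearMap.comp
    (ContinuousLinearMap.pi fun i : Fin p =>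
      if (i : ℕ) = 0 then ∑ j : Fin p, (A j).comp (PiLp.proj 2 (fun _ : Fin p => H) j)
      else PiLp.proj 2 (fun _ : Fin p => H) ⟨(i : ℕ) - 1, by omega⟩)

/-- The stability condition: some power of the companion operator has norm less than one. -/
def StabilityCondition {p : ℕ} (A : Fin p → H →L[ℝ] H) : Prop :=
  ∃ j₀ : ℕ, ‖companion A ^ j₀‖ < 1

variable [MeasurableSpace H]

/-- A centred i.i.d. sequence of random elements of `H` with finite second moment. -/
structure IsNoise (P : Measure Ω) (ε : ℤ → Ω → H) : Prop where
  measurable : ∀ t, Measurable (ε t)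
  indep : iIndepFun ε P
  identDistrib : ∀ t, IdentDistrib (ε t) (ε 0) P P
  memLp : MemLp (ε 0) 2 P
  mean_zero : ∫ ω, ε 0 ω ∂P = 0

/-- The σ-algebra generated by the noise up to time `t`. -/
abbrev past (ε : ℤ → Ω → H) (t : ℤ) : MeasurableSpace Ω :=
  ⨆ s : {s : ℤ // s ≤ t}, MeasurableSpace.comap (ε s) inferInstance

/-- A centred process with finite second moments that is causal with respect to the noise:
up to null sets, `X t` is a measurable function of `ε t, ε (t - 1), …`. -/
structure IsCausalProcess (P : Measure Ω) (ε X : ℤ → Ω → H) : Prop where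
  memLp : ∀ t, MemLp (X t) 2 P
  mean_zero : ∀ t, ∫ ω, X t ω ∂P = 0
  causal : ∀ t, AEStronglyMeasurable[past ε t] (X t) P

/-- `X` is the (causal) FARMA(p, q) process with autoregressive operators `A₁, …, A_p`
(`A_{j+1}` is `A j`), moving average operators `B₁, …, B_q` and innovations `ε`. -/
structure IsFARMA (P : Measure Ω) {p q : ℕ} (A : Fin p → H →L[ℝ] H) (B : Fin q → H →L[ℝ] H)
    (ε X : ℤ → Ω → H) : Prop extends IsCausalProcess P ε X where
  equation : ∀ t : ℤ, ∀ᵐ ω ∂P, X t ω = ∑ j : Fin p, A j (X (t - (j + 1 : ℕ)) ω) + ε t ω +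
    ∑ j : Fin q, B j (ε (t - (j + 1 : ℕ)) ω)

/-- The coefficient of `z ^ k` in the binomial series of `(1 - z) ^ d`. -/
def fracCoeff (d : ℝ) (k : ℕ) : ℝ := (-1) ^ k * Ring.choose d k

/-- `Y` is the (causal) FARFIMA(p, d, q) process: `(1 - Δ) ^ d Y = X`, where `Δ` is the backshift
operator and `X` is the FARMA(p, q) process; the series `∑ k, π_k Y (t - k)`, whose coefficients
are those of `(1 - z) ^ d`, converges to `X t` in mean square. -/
structure IsFARFIMA (P : Measure Ω) {p q : ℕ} (A : Fin p → H →L[ℝ] H) (d : ℝ)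
    (B : Fin q → H →L[ℝ] H) (ε Y : ℤ → Ω → H) : Prop extends IsCausalProcess P ε Y where
  equation : ∃ X : ℤ → Ω → H, IsFARMA P A B ε X ∧ ∀ t : ℤ,
    Tendsto (fun n : ℕ => eLpNorm
      (fun ω => ∑ k ∈ Finset.range n, fracCoeff d k • Y (t - k) ω - X t ω) 2 P) atTop (𝓝 0)

end TimeSeries

/-! ### The spectral densities -/

section SpectralDensity

variable {H : Type*} [NormedAddCommGroup H] [InnerProductSpace ℝ H]

/-- The autoregressive polynomial `𝓐(z) = 1 - A₁ z - ⋯ - A_p z^p`. -/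
def arPoly {p : ℕ} (A : Fin p → H →L[ℝ] H) (z : ℂ) :
    Complexification H →L[ℂ] Complexification H :=
  1 - ∑ j : Fin p, z ^ ((j : ℕ) + 1) • Complexification.map (A j)

/-- The moving average polynomial `𝓑(z) = 1 + B₁ z + ⋯ + B_q z^q`. -/
def maPoly {q : ℕ} (B : Fin q → H →L[ℝ] H) (z : ℂ) :
    Complexification H →L[ℂ] Complexification H :=
  1 + ∑ j : Fin q, z ^ ((j : ℕ) + 1) • Complexification.map (B j)

/-- The FARMA spectral density operator
`(2π)⁻¹ 𝓐(z)⁻¹ 𝓑(z) S 𝓑(z)^* (𝓐(z)^*)⁻¹` at `z = exp (-i ω)`. -/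
def farmaSpectralDensity [CompleteSpace H] {p q : ℕ} (A : Fin p → H →L[ℝ] H)
    (B : Fin q → H →L[ℝ] H) (S : H →L[ℝ] H) (ω : ℝ) :
    Complexification H →L[ℂ] Complexification H :=
  ((2 * Real.pi : ℝ) : ℂ)⁻¹ •
    (Ring.inverse (arPoly A (Complex.exp (-Complex.I * ω))) *
      maPoly B (Complex.exp (-Complex.I * ω)) *
      Complexification.map S *
      ContinuousLinearMap.adjoint (maPoly B (Complex.exp (-Complex.I * ω))) *
      Ring.inverse (ContinuousLinearMap.adjoint (arPoly A (Complex.exp (-Complex.I * ω)))))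

end SpectralDensity

end FTS

end

/-!
Expand `(1 - z) ^ (-d) 𝓐(z)⁻¹ 𝓑(z) = ∑ k, Θ_k z ^ k` as a formal power series with operator
coefficients. The first claim is that `Θ` is the impulse response of the FARFIMA process `Y`, with
no regard to convergence: the recursion expressing `Y t` through the noise is triangular, so
subtracting the first `n` terms of `∑ k, Θ_k ε (t - k)` from `Y t` leaves a variable measurable with
respect to the noise up to time `t - n` (`HasResponse.of_filter`, `IsFARFIMA.hasResponse`). The
increments of these remainders are orthogonal to the later remainders, hence their inner
products with a fixed vector converge in `L²`; the limit is centred and lies in the remote past, so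
it vanishes by Kolmogorov's zero-one law (`HasResponse.tendsto_remainder`). It follows that
`Cov(Y (t + h), Y t) = ∑ k, Θ_{k+h} S Θ_k^*` (`HasResponse.crossCov_eq_tsum`).

For the frequency domain, `Θ` is the composition of the square-summable scalar filter `(1 - z) ^ (-d)`
and the absolutely summable operator filter `Ψ = 𝓐⁻¹ 𝓑`; the summability of `Ψ` is the stability
condition, read through the powers of the companion operator (`summable_norm_coeff_arInverse`).
Rearranging the absolutely convergent sum `∑ k, Θ_{k+h} S Θ_k^*` reduces it to the autocovariances of
the scalar filter (`hasSum_filterCoeff_sandwich`), and these are the Fourier coefficients of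
`(2 sin (ω / 2)) ^ (-2d)` (`integral_sin_rpow_mul_exp`, from Parseval's identity for
`|1 - r e^{-iω}| ^ (-2d)` as `r` increases to one). Summing up gives the inversion formula
(`map_tsum_filterCoeff_sandwich`).

That the density is integrable in trace norm rests on Bessel's inequality: under the expectation it
gives `‖C S D^*‖₁ ≤ ‖C‖ ‖D‖ 𝔼‖ε₀‖²` (`traceNorm_sandwich_le`), so that `ω ↦ Ψ S Ψ^*` is continuous
into the trace-class operators, and the scalar factor is integrable since `-2d > -1`.
-/

noncomputable section

namespace FTS

/-! ### Fourier coefficients of the fractional filter -/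

/-- The extension by zero of a sequence to negative indices. -/
def zeroExtend {M : Type*} [Zero M] (f : ℕ → M) (k : ℤ) : M := if 0 ≤ k then f k.toNat else 0

@[simp] theorem zeroExtend_natCast {M : Type*} [Zero M] (f : ℕ → M) (k : ℕ) :
    zeroExtend f (k : ℤ) = f k := by
  simp [zeroExtend]

theorem zeroExtend_of_neg {M : Type*} [Zero M] (f : ℕ → M) {k : ℤ} (hk : k < 0) :
    zeroExtend f k = 0 := by
  simp [zeroExtend, hk]

theorem hasSum_zeroExtend {M N : Type*} [Zero M] [AddCommMonoid N] [TopologicalSpace N]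
    {f : ℕ → M} {g : ℤ → M → N} (hg : ∀ k, g k 0 = 0) {a : N}
    (h : HasSum (fun k : ℕ => g k (f k)) a) : HasSum (fun k : ℤ => g k (zeroExtend f k)) a := by
  rw [← (Nat.cast_injective (R := ℤ)).hasSum_iff]
  · simpa [Function.comp_def] using h
  · intro k hk
    rw [zeroExtend_of_neg, hg]
    by_contra! h0
    exact hk ⟨k.toNat, by simp [h0]⟩

theorem integral_exp_int_mul (n : ℤ) :
    ∫ ω in (0 : ℝ)..(2 * Real.pi), Complex.exp (Complex.I * n * ω) =
      if n = 0 then ((2 * Real.pi : ℝ) : ℂ) else 0 := by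
  split_ifs with h
  · simp [h]
  · rw [integral_exp_mul_complex (by simp [h])]
    have : Complex.exp (Complex.I * n * ((2 * Real.pi : ℝ) : ℂ)) = 1 :=
      Complex.exp_eq_one_iff.2 ⟨n, by push_cast; ring⟩
    rw [this]
    simp

theorem norm_exp_I_int_mul (n : ℤ) (ω : ℝ) : ‖Complex.exp (Complex.I * n * ω)‖ = 1 := by
  rw [show Complex.I * n * ω = ((n * ω : ℝ) : ℂ) * Complex.I by push_cast; ring,
    Complex.norm_exp_ofReal_mul_I]

theorem exp_int_mul_mul (m n : ℤ) (ω : ℝ) : Complex.exp (Complex.I * m * ω) *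
    Complex.exp (Complex.I * n * ω) = Complex.exp (Complex.I * (m + n : ℤ) * ω) := by
  rw [← Complex.exp_add]; push_cast; ring_nf

theorem conj_exp_int_mul (n : ℤ) (ω : ℝ) : (starRingEnd ℂ) (Complex.exp (Complex.I * n * ω)) =
    Complex.exp (Complex.I * (-n : ℤ) * ω) := by
  rw [← Complex.exp_conj]; simp

/-- Parseval's identity for an absolutely convergent Fourier series with real coefficients. -/
theorem integral_normSq_fourier {a : ℤ → ℝ} (ha : Summable fun k => ‖a k‖) (m : ℤ) :
    ∫ ω in (0 : ℝ)..(2 * Real.pi),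
      ((‖∑' k : ℤ, (a k : ℂ) * Complex.exp (Complex.I * (-k : ℤ) * ω)‖ ^ 2 : ℝ) : ℂ) *
        Complex.exp (Complex.I * m * ω) =
      (2 * Real.pi : ℝ) * (∑' l : ℤ, a (l + m) * a l : ℝ) := by
  have h0 : (0 : ℝ) ≤ 2 * Real.pi := by positivity
  set G : ℤ × ℤ → ℝ → ℂ := fun x ω => ((a x.1 * a x.2 : ℝ) : ℂ) *
    Complex.exp (Complex.I * (m - x.1 + x.2 : ℤ) * ω) with hG
  have hsum2 : Summable fun x : ℤ × ℤ => ‖a x.1 * a x.2‖ :=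
    (summable_mul_of_summable_norm ha ha).norm
  have hpt : ∀ ω : ℝ,
      ((‖∑' k : ℤ, (a k : ℂ) * Complex.exp (Complex.I * (-k : ℤ) * ω)‖ ^ 2 : ℝ) : ℂ) *
        Complex.exp (Complex.I * m * ω) = ∑' x, G x ω := by
    intro ω
    have h1 : Summable fun k : ℤ => ‖(a k : ℂ) * Complex.exp (Complex.I * (-k : ℤ) * ω)‖ := by
      simpa only [norm_mul, norm_exp_I_int_mul, mul_one, Complex.norm_real] using ha
    have h2 : Summable fun k : ℤ => ‖(a k : ℂ) * Complex.exp (Complex.I * k * ω)‖ := by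
      simpa only [norm_mul, norm_exp_I_int_mul, mul_one, Complex.norm_real] using ha
    rw [← Complex.normSq_eq_norm_sq, Complex.normSq_eq_conj_mul_self, Complex.conj_tsum, mul_comm
      (tsum _)]
    simp only [map_mul, Complex.conj_ofReal, conj_exp_int_mul, neg_neg]
    rw [tsum_mul_tsum_of_summable_norm h1 h2, ← tsum_mul_right]
    refine tsum_congr fun x => ?_
    rw [hG]
    simp only
    rw [show m - x.1 + x.2 = -x.1 + x.2 + m by ring, ← exp_int_mul_mul, ← exp_int_mul_mul]
    push_cast
    ring
  have hint : HasSum (fun x => ∫ ω in (0 : ℝ)..(2 * Real.pi), G x ω)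
      (∫ ω in (0 : ℝ)..(2 * Real.pi), ∑' x, G x ω) := by
    simp only [intervalIntegral.integral_of_le h0]
    refine MeasureTheory.hasSum_integral_of_summable_integral_norm (fun x => ?_) ?_
    · have : Continuous (G x) := by simp only [hG]; fun_prop
      exact (this.intervalIntegrable 0 (2 * Real.pi)).1
    · simp only [hG, norm_mul, norm_exp_I_int_mul, mul_one, Complex.norm_real]
      simp only [integral_const]
      refine Summable.mul_left _ ?_
      simpa using hsum2
  simp_rw [hpt]
  have hval : ∀ x, ∫ ω in (0 : ℝ)..(2 * Real.pi), G x ω =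
      if m - x.1 + x.2 = 0 then ((a x.1 * a x.2 * (2 * Real.pi) : ℝ) : ℂ) else 0 := by
    intro x
    simp only [hG]
    rw [intervalIntegral.integral_const_mul, integral_exp_int_mul]
    split_ifs <;> simp
  simp_rw [hval] at hint
  -- only the pairs `(l + m, l)` contribute
  have hinj : Function.Injective (fun l : ℤ => ((l + m, l) : ℤ × ℤ)) := fun l l' h => by
    simpa using congrArg Prod.snd h
  rw [← hinj.hasSum_iff] at hint
  · rw [← hint.tsum_eq, Complex.ofReal_tsum, ← tsum_mul_left]
    refine tsum_congr fun l => ?_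
    simp [mul_comm]
  · rintro ⟨k, l⟩ hx
    rw [if_neg]
    intro h
    exact hx ⟨l, by ext <;> simp; linarith⟩

/-- The binomial series of `(1 - z) ^ e`, for the principal branch. -/
theorem fracCoeff_hasSum (e : ℝ) {z : ℂ} (hz : ‖z‖ < 1) :
    HasSum (fun k : ℕ => (fracCoeff e k : ℂ) * z ^ k) ((1 - z) ^ (e : ℂ)) := by
  have h := (Complex.one_add_cpow_hasFPowerSeriesOnBall_zero (a := (e : ℂ))).hasSum
    (y := -z) (by simpa [Metric.mem_eball, edist_zero_right, ← ofReal_norm] using hz)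
  rw [zero_add, ← sub_eq_add_neg] at h
  convert! h using 2 with k
  rw [binomialSeries_apply]
  simp [fracCoeff, Complex.ofReal_choose, neg_pow z k]
  ring

theorem summable_norm_fracCoeff_mul_pow (e : ℝ) {r : ℝ} (hr : 0 ≤ r) (hr1 : r < 1) :
    Summable fun k : ℕ => ‖fracCoeff e k * r ^ k‖ := by
  have := (fracCoeff_hasSum e (z := (r : ℂ)) (by simpa [abs_of_nonneg hr] using hr1)).summable.norm
  simpa using this

theorem tsum_fracCoeff_fourier (e : ℝ) {r : ℝ} (hr : 0 ≤ r) (hr1 : r < 1) (ω : ℝ) :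
    ∑' k : ℤ, ((zeroExtend (fun k => fracCoeff e k * r ^ k) k : ℝ) : ℂ) *
      Complex.exp (Complex.I * (-k : ℤ) * ω) =
    (1 - r * Complex.exp (-Complex.I * ω)) ^ (e : ℂ) := by
  have hz : ‖(r : ℂ) * Complex.exp (-Complex.I * ω)‖ < 1 := by
    have := norm_exp_I_int_mul (-1) ω
    push_cast at this
    rw [mul_neg_one] at this
    rw [norm_mul, this, mul_one, Complex.norm_real, Real.norm_eq_abs, abs_of_nonneg hr]
    exact hr1
  refine (hasSum_zeroExtend (f := fun k => fracCoeff e k * r ^ k) (g := fun (k : ℤ) (x : ℝ) =>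
    (x : ℂ) * Complex.exp (Complex.I * (-k : ℤ) * ω)) (by simp) ?_).tsum_eq
  convert! fracCoeff_hasSum e hz using 2 with k
  rw [mul_pow, ← Complex.exp_nat_mul]
  push_cast
  rw [mul_assoc]
  congr 3
  ring

theorem summable_norm_zeroExtend_fracCoeff (e : ℝ) {r : ℝ} (hr : 0 ≤ r) (hr1 : r < 1) :
    Summable fun k : ℤ => ‖zeroExtend (fun k => fracCoeff e k * r ^ k) k‖ :=
  (hasSum_zeroExtend (g := fun _ x => ‖x‖) (by simp)
    (summable_norm_fracCoeff_mul_pow e hr hr1).hasSum).summable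

/-- The autocovariances of the sequence `ψ_k r ^ k`, where `∑ ψ_k z ^ k = (1 - z) ^ e`, as Fourier
coefficients. -/
theorem integral_norm_one_sub_rpow (e : ℝ) {r : ℝ} (hr : 0 ≤ r) (hr1 : r < 1) (m : ℤ) :
    ∫ ω in (0 : ℝ)..(2 * Real.pi),
      ((‖1 - r * Complex.exp (-Complex.I * ω)‖ ^ (2 * e) : ℝ) : ℂ) *
        Complex.exp (Complex.I * m * ω) =
      (2 * Real.pi : ℝ) * (∑' l : ℤ, zeroExtend (fun k => fracCoeff e k * r ^ k) (l + m) *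
        zeroExtend (fun k => fracCoeff e k * r ^ k) l : ℝ) := by
  rw [← integral_normSq_fourier (summable_norm_zeroExtend_fracCoeff e hr hr1)]
  refine intervalIntegral.integral_congr fun ω _ => ?_
  rw [tsum_fracCoeff_fourier e hr hr1, Complex.norm_cpow_real,
    ← Real.rpow_mul_natCast (by positivity), mul_comm e]
  norm_num

theorem norm_one_sub_exp (ω : ℝ) (hω : ω ∈ Set.Icc 0 (2 * Real.pi)) :
    ‖1 - Complex.exp (-Complex.I * ω)‖ = 2 * Real.sin (ω / 2) := by
  have h := Complex.norm_exp_I_mul_ofReal_sub_one (-ω)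
  rw [norm_sub_rev] at h
  have hs : 0 ≤ Real.sin (ω / 2) :=
    Real.sin_nonneg_of_nonneg_of_le_pi (by linarith [hω.1]) (by linarith [hω.2])
  rw [neg_div, Real.sin_neg, mul_neg, norm_neg, Real.norm_of_nonneg (by positivity)] at h
  rw [← h]
  simp

theorem sin_half_pos {ω : ℝ} (hω : ω ∈ Set.Ioo 0 (2 * Real.pi)) : 0 < Real.sin (ω / 2) :=
  Real.sin_pos_of_pos_of_lt_pi (by linarith [hω.1]) (by linarith [hω.2])

/-- For negative `e` the singularities at both ends are compared with powers by Jordan's inequality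
`2 x / π ≤ sin x`. -/
theorem intervalIntegrable_sin_rpow {e : ℝ} (he : -1 / 2 < e) :
    IntervalIntegrable (fun ω => (2 * Real.sin (ω / 2)) ^ (2 * e)) volume 0 (2 * Real.pi) := by
  rcases le_or_gt 0 e with h0 | h0
  · refine Continuous.intervalIntegrable ?_ _ _
    exact Continuous.rpow_const (by fun_prop) fun _ => Or.inr (by linarith)
  have h1 : IntervalIntegrable (fun ω : ℝ => ω ^ (2 * e)) volume 0 (2 * Real.pi) :=
    intervalIntegral.intervalIntegrable_rpow' (by linarith)
  have h2 : IntervalIntegrable (fun ω : ℝ => (2 * Real.pi - ω) ^ (2 * e)) volume 0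
      (2 * Real.pi) := by
    have := (h1.comp_sub_left (2 * Real.pi)).symm
    simpa using this
  refine ((h1.const_mul ((2 / Real.pi) ^ (2 * e))).add
    (h2.const_mul ((2 / Real.pi) ^ (2 * e)))).mono_fun' ?_ ?_
  · exact (Measurable.pow_const (by fun_prop) _).aestronglyMeasurable
  have hpi : (0 : ℝ) < 2 * Real.pi := by positivity
  rw [Set.uIoc_of_le hpi.le]
  have hne : ∀ᵐ ω : ℝ, ω ≠ 2 * Real.pi := by simp [ae_iff, measure_singleton]
  filter_upwards [ae_restrict_mem measurableSet_Ioc, ae_restrict_of_ae hne] with ω hω hω2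
  have hω' : ω < 2 * Real.pi := lt_of_le_of_ne hω.2 hω2
  have hs := sin_half_pos ⟨hω.1, hω'⟩
  rw [Real.norm_of_nonneg (by positivity)]
  have key : ∀ x : ℝ, 0 < x → x ≤ Real.pi →
      (2 * Real.sin (x / 2)) ^ (2 * e) ≤ (2 / Real.pi) ^ (2 * e) * x ^ (2 * e) := by
    intro x hx hxp
    rw [← Real.mul_rpow (by positivity) hx.le]
    refine Real.rpow_le_rpow_of_nonpos (by positivity) ?_ (by linarith)
    have := Real.mul_le_sin (x := x / 2) (by linarith) (by linarith)
    linarith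
  have hp1 : 0 ≤ (2 / Real.pi) ^ (2 * e) * ω ^ (2 * e) := by
    have := hω.1; positivity
  have hp2 : 0 ≤ (2 / Real.pi) ^ (2 * e) * (2 * Real.pi - ω) ^ (2 * e) := by
    have : 0 < 2 * Real.pi - ω := by linarith
    positivity
  rcases le_total ω Real.pi with h | h
  · linarith [key ω hω.1 h]
  · have := key (2 * Real.pi - ω) (by linarith) (by linarith)
    rw [show (2 * Real.pi - ω) / 2 = Real.pi - ω / 2 by ring, Real.sin_pi_sub] at this
    linarith

/-- A majorant of `|1 - r exp (-i ω)| ^ (2 e)` uniform in `r`; for negative `e` it comes from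
`|1 - exp (-i ω)| ≤ 2 |1 - r exp (-i ω)|`. -/
theorem norm_one_sub_rpow_le (e : ℝ) {r : ℝ} (hr : 0 ≤ r) (hr1 : r < 1) {ω : ℝ}
    (hω : ω ∈ Set.Ioo 0 (2 * Real.pi)) :
    ‖1 - r * Complex.exp (-Complex.I * ω)‖ ^ (2 * e) ≤
      2 ^ (2 * e) + 2⁻¹ ^ (2 * e) * (2 * Real.sin (ω / 2)) ^ (2 * e) := by
  have hs := sin_half_pos hω
  have hexp : ‖Complex.exp (-Complex.I * ω)‖ = 1 := by
    have := norm_exp_I_int_mul (-1) ω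
    push_cast at this
    rwa [mul_neg_one] at this
  rcases le_or_gt 0 e with h0 | h0
  · have h1 : ‖1 - r * Complex.exp (-Complex.I * ω)‖ ≤ 2 := by
      refine (norm_sub_le _ _).trans ?_
      rw [norm_mul, hexp, norm_one, Complex.norm_real, Real.norm_of_nonneg hr]
      linarith
    have h2 := Real.rpow_le_rpow (norm_nonneg _) h1 (by linarith : 0 ≤ 2 * e)
    have : 0 ≤ (2 : ℝ)⁻¹ ^ (2 * e) * (2 * Real.sin (ω / 2)) ^ (2 * e) := by positivity
    linarith
  · have h1 : 2⁻¹ * (2 * Real.sin (ω / 2)) ≤ ‖1 - r * Complex.exp (-Complex.I * ω)‖ := by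
      rw [← norm_one_sub_exp ω ⟨hω.1.le, hω.2.le⟩]
      have h3 : ‖1 - Complex.exp (-Complex.I * ω)‖ ≤
          ‖1 - r * Complex.exp (-Complex.I * ω)‖ + (1 - r) := by
        have : 1 - Complex.exp (-Complex.I * ω) = (1 - r * Complex.exp (-Complex.I * ω)) -
          ((1 - r : ℝ) : ℂ) * Complex.exp (-Complex.I * ω) := by push_cast; ring
        rw [this]
        refine (norm_sub_le _ _).trans ?_
        rw [norm_mul, hexp, mul_one, Complex.norm_real, Real.norm_of_nonneg (by linarith)]
      have h4 : 1 - r ≤ ‖1 - r * Complex.exp (-Complex.I * ω)‖ := by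
        refine le_trans ?_ (norm_sub_norm_le _ _)
        rw [norm_mul, hexp, norm_one, Complex.norm_real, Real.norm_of_nonneg hr]
        linarith
      linarith
    have h2 := Real.rpow_le_rpow_of_nonpos (by positivity) h1 (by linarith : 2 * e ≤ 0)
    rw [Real.mul_rpow (by norm_num) (by positivity)] at h2
    have : (0 : ℝ) ≤ 2 ^ (2 * e) := by positivity
    linarith

theorem intervalIntegrable_rpow_bound {e : ℝ} (he : -1 / 2 < e) :
    IntervalIntegrable (fun ω => 2 ^ (2 * e) + 2⁻¹ ^ (2 * e) * (2 * Real.sin (ω / 2)) ^ (2 * e))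
      volume 0 (2 * Real.pi) :=
  (intervalIntegrable_const).add ((intervalIntegrable_sin_rpow he).const_mul _)

theorem ae_mem_Ioo_of_mem_uIoc : ∀ᵐ ω : ℝ, ω ∈ Set.uIoc 0 (2 * Real.pi) →
    ω ∈ Set.Ioo 0 (2 * Real.pi) := by
  have hpi : (0 : ℝ) < 2 * Real.pi := by positivity
  rw [Set.uIoc_of_le hpi.le]
  have hne : ∀ᵐ ω : ℝ, ω ≠ 2 * Real.pi := by simp [ae_iff, measure_singleton]
  filter_upwards [hne] with ω h h'
  exact ⟨h'.1, lt_of_le_of_ne h'.2 h⟩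

theorem continuous_norm_one_sub (r : ℝ) :
    Continuous fun ω : ℝ => ‖1 - r * Complex.exp (-Complex.I * ω)‖ := by fun_prop

theorem tendsto_integral_norm_one_sub_rpow {e : ℝ} (he : -1 / 2 < e) (m : ℤ) :
    Tendsto (fun r : ℝ => ∫ ω in (0 : ℝ)..(2 * Real.pi),
      ((‖1 - r * Complex.exp (-Complex.I * ω)‖ ^ (2 * e) : ℝ) : ℂ) *
        Complex.exp (Complex.I * m * ω)) (𝓝[<] 1)
      (𝓝 (∫ ω in (0 : ℝ)..(2 * Real.pi), (((2 * Real.sin (ω / 2)) ^ (2 * e) : ℝ) : ℂ) *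
        Complex.exp (Complex.I * m * ω))) := by
  have hev : ∀ᶠ r : ℝ in 𝓝[<] 1, r ∈ Set.Ioo 0 1 := Ioo_mem_nhdsLT one_pos
  refine intervalIntegral.tendsto_integral_filter_of_dominated_convergence _ ?_ ?_
    (intervalIntegrable_rpow_bound he) ?_
  · filter_upwards with r
    refine Measurable.aestronglyMeasurable ?_
    refine Measurable.mul (Complex.measurable_ofReal.comp
      ((continuous_norm_one_sub r).measurable.pow_const _)) ?_
    exact Continuous.measurable (by fun_prop)
  · filter_upwards [hev] with r hr
    filter_upwards [ae_mem_Ioo_of_mem_uIoc] with ω hω hω'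
    rw [norm_mul, norm_exp_I_int_mul, mul_one, Complex.norm_real,
      Real.norm_of_nonneg (by positivity)]
    exact norm_one_sub_rpow_le e hr.1.le hr.2 (hω hω')
  · filter_upwards [ae_mem_Ioo_of_mem_uIoc] with ω hω hω'
    have hs := sin_half_pos (hω hω')
    have hn := norm_one_sub_exp ω ⟨(hω hω').1.le, (hω hω').2.le⟩
    refine Tendsto.mul_const _ ?_
    refine (Complex.continuous_ofReal.tendsto _).comp ?_
    rw [← hn]
    refine Tendsto.rpow_const ?_ (Or.inl (by rw [hn]; positivity))
    have : Continuous fun r : ℝ => ‖1 - r * Complex.exp (-Complex.I * ω)‖ := by fun_prop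
    have h := (this.tendsto 1).mono_left (nhdsWithin_le_nhds (s := Set.Iio 1))
    simpa using h

/-- The partial sums of `∑ ψ_k² r ^ (2 k)` are bounded by the zeroth Fourier coefficient, uniformly
as `r` increases to one. -/
theorem summable_sq_fracCoeff {e : ℝ} (he : -1 / 2 < e) :
    Summable fun k : ℕ => fracCoeff e k ^ 2 := by
  set L := ∫ ω in (0 : ℝ)..(2 * Real.pi), (((2 * Real.sin (ω / 2)) ^ (2 * e) : ℝ) : ℂ) *
        Complex.exp (Complex.I * (0 : ℤ) * ω) with hL
  refine summable_of_sum_le (c := L.re / (2 * Real.pi)) (fun _ => sq_nonneg _) fun s => ?_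
  have hev : ∀ᶠ r : ℝ in 𝓝[<] 1, r ∈ Set.Ioo 0 1 := Ioo_mem_nhdsLT one_pos
  have hlim := (Complex.continuous_re.tendsto _).comp (tendsto_integral_norm_one_sub_rpow he 0)
  have hlim2 := hlim.div_const (2 * Real.pi)
  have hcont : Continuous fun r : ℝ => ∑ k ∈ s, (fracCoeff e k * r ^ k) ^ 2 := by fun_prop
  have hl := (hcont.tendsto 1).mono_left (nhdsWithin_le_nhds (s := Set.Iio 1))
  simp only [one_pow, mul_one] at hl
  refine le_of_tendsto_of_tendsto hl hlim2 ?_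
  filter_upwards [hev] with r hr
  simp only [Function.comp]
  rw [integral_norm_one_sub_rpow e hr.1.le hr.2 0, ← Complex.ofReal_mul, Complex.ofReal_re,
    mul_div_cancel_left₀ _ (by positivity)]
  simp only [add_zero, ← sq]
  have hsum : Summable fun k : ℕ => (fracCoeff e k * r ^ k) ^ 2 := by
    have h := summable_norm_fracCoeff_mul_pow e hr.1.le hr.2
    have h2 := (summable_mul_of_summable_norm h h).comp_injective
      (i := fun k : ℕ => (k, k)) (fun a b h => by simpa using h)
    simpa [Function.comp_def, ← sq] using h2
  rw [(hasSum_zeroExtend (g := fun _ x => x ^ 2) (by simp) hsum.hasSum).tsum_eq]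
  exact hsum.sum_le_tsum s fun _ _ => sq_nonneg _

theorem summable_sq_zeroExtend_fracCoeff {e : ℝ} (he : -1 / 2 < e) :
    Summable fun k : ℤ => zeroExtend (fracCoeff e) k ^ 2 :=
  (hasSum_zeroExtend (g := fun _ x => x ^ 2) (by simp) (summable_sq_fracCoeff he).hasSum).summable

theorem summable_mul_shift {a : ℤ → ℝ} (ha : Summable fun k => a k ^ 2) (m n : ℤ) :
    Summable fun l => |a (l + m) * a (l + n)| := by
  have h1 : ∀ m : ℤ, Summable fun l : ℤ => a (l + m) ^ 2 := fun m =>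
    ha.comp_injective (add_left_injective m)
  refine Summable.of_nonneg_of_le (fun _ => abs_nonneg _) (fun l => ?_) ((h1 m).add (h1 n))
  rw [abs_mul, ← sq_abs (a (l + m)), ← sq_abs (a (l + n))]
  nlinarith [sq_nonneg (|a (l + m)| - |a (l + n)|), sq_nonneg (|a (l + m)|),
    sq_nonneg (|a (l + n)|)]

/-- The autocovariance at lag `m` of the coefficients of `(1 - z) ^ e` is the `m`-th Fourier
coefficient of `|1 - exp (-i ω)| ^ (2 e) = (2 sin (ω / 2)) ^ (2 e)`. -/
theorem integral_sin_rpow_mul_exp {e : ℝ} (he : -1 / 2 < e) (m : ℤ) :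
    ∫ ω in (0 : ℝ)..(2 * Real.pi), (((2 * Real.sin (ω / 2)) ^ (2 * e) : ℝ) : ℂ) *
        Complex.exp (Complex.I * m * ω) =
      (2 * Real.pi : ℝ) * (∑' l : ℤ, zeroExtend (fracCoeff e) (l + m) *
        zeroExtend (fracCoeff e) l : ℝ) := by
  have hev : ∀ᶠ r : ℝ in 𝓝[<] 1, r ∈ Set.Ioo 0 1 := Ioo_mem_nhdsLT one_pos
  refine tendsto_nhds_unique (tendsto_integral_norm_one_sub_rpow he m) ?_
  have hsum := summable_mul_shift (summable_sq_zeroExtend_fracCoeff he) m 0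
  simp only [add_zero] at hsum
  have key : Tendsto (fun r : ℝ => ∑' l : ℤ,
      zeroExtend (fun k => fracCoeff e k * r ^ k) (l + m) *
        zeroExtend (fun k => fracCoeff e k * r ^ k) l) (𝓝[<] 1)
      (𝓝 (∑' l : ℤ, zeroExtend (fracCoeff e) (l + m) * zeroExtend (fracCoeff e) l)) := by
    refine tendsto_tsum_of_dominated_convergence hsum (fun l => ?_) ?_
    · have h1 : ∀ k : ℤ, Tendsto (fun r : ℝ => zeroExtend (fun k => fracCoeff e k * r ^ k) k)
          (𝓝[<] 1) (𝓝 (zeroExtend (fracCoeff e) k)) := by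
        intro k
        unfold zeroExtend
        split_ifs
        · have : Continuous fun r : ℝ => fracCoeff e k.toNat * r ^ k.toNat := by fun_prop
          simpa using (this.tendsto 1).mono_left (nhdsWithin_le_nhds (s := Set.Iio 1))
        · exact tendsto_const_nhds
      exact (h1 _).mul (h1 _)
    · filter_upwards [hev] with r hr l
      have h1 : ∀ k : ℤ, |zeroExtend (fun k => fracCoeff e k * r ^ k) k| ≤
          |zeroExtend (fracCoeff e) k| := by
        intro k
        unfold zeroExtend
        split_ifs
        · rw [abs_mul, abs_of_nonneg (pow_nonneg hr.1.le _)]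
          exact mul_le_of_le_one_right (abs_nonneg _) (pow_le_one₀ hr.1.le hr.2.le)
        · simp
      rw [norm_mul, abs_mul]
      exact mul_le_mul (h1 _) (h1 _) (abs_nonneg _) (abs_nonneg _)
  refine Tendsto.congr' ?_ (((Complex.continuous_ofReal.tendsto _).comp key).const_mul
    ((2 * Real.pi : ℝ) : ℂ))
  filter_upwards [hev] with r hr
  rw [integral_norm_one_sub_rpow e hr.1.le hr.2 m]
  rfl

/-! ### Power series with operator coefficients -/

section PowerSeriesCalculus

open PowerSeries

variable {R 𝓐 : Type*} [NormedRing R] [NormedRing 𝓐] [NormedAlgebra ℂ 𝓐] (φ : R →+* 𝓐)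

/-- The value at `z` of a power series with coefficients in `R`, taken in the complex
algebra `𝓐` along `φ`. -/
def symbol (φ : R →+* 𝓐) (f : PowerSeries R) (z : ℂ) : 𝓐 :=
  ∑' n, z ^ n • φ (coeff n f)

theorem norm_symbol_term_le (hφ : ∀ T, ‖φ T‖ ≤ ‖T‖) (f : PowerSeries R) {z : ℂ} (hz : ‖z‖ = 1)
    (n : ℕ) : ‖z ^ n • φ (coeff n f)‖ ≤ ‖coeff n f‖ := by
  rw [norm_smul, norm_pow, hz, one_pow, one_mul]
  exact hφ _

theorem summable_symbol_term (hφ : ∀ T, ‖φ T‖ ≤ ‖T‖) {f : PowerSeries R}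
    (hf : Summable fun n => ‖coeff n f‖) {z : ℂ} (hz : ‖z‖ = 1) :
    Summable fun n => ‖z ^ n • φ (coeff n f)‖ :=
  Summable.of_nonneg_of_le (fun _ => norm_nonneg _) (norm_symbol_term_le φ hφ f hz) hf

theorem summable_norm_coeff_mul {f g : PowerSeries R}
    (hf : Summable fun n => ‖coeff n f‖) (hg : Summable fun n => ‖coeff n g‖) :
    Summable fun n => ‖coeff n (f * g)‖ := by
  have h := summable_norm_sum_mul_antidiagonal_of_summable_norm (f := fun n => coeff n f)
    (g := fun n => coeff n g) hf hg
  simpa only [coeff_mul] using h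

/-- The symbol is multiplicative on the unit circle for absolutely summable series, by the Cauchy
product; the coefficients need not commute. -/
theorem symbol_mul [CompleteSpace 𝓐] (hφ : ∀ T, ‖φ T‖ ≤ ‖T‖) {f g : PowerSeries R}
    (hf : Summable fun n => ‖coeff n f‖)
    (hg : Summable fun n => ‖coeff n g‖) {z : ℂ} (hz : ‖z‖ = 1) :
    symbol φ (f * g) z = symbol φ f z * symbol φ g z := by
  unfold symbol
  rw [tsum_mul_tsum_eq_tsum_sum_antidiagonal_of_summable_norm (summable_symbol_term φ hφ hf hz)
    (summable_symbol_term φ hφ hg hz)]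
  refine tsum_congr fun n => ?_
  rw [coeff_mul, map_sum, Finset.smul_sum]
  refine Finset.sum_congr rfl fun k hk => ?_
  rw [map_mul, smul_mul_smul_comm, ← pow_add, Finset.HasAntidiagonal.mem_antidiagonal.1 hk]

theorem hasSum_symbol_one (z : ℂ) :
    HasSum (fun n => z ^ n • φ (coeff n (1 : PowerSeries R))) 1 := by
  have h := hasSum_single (f := fun n => z ^ n • φ (coeff n (1 : PowerSeries R))) 0
    fun n hn => by
      simp only [coeff_one, if_neg hn]
      rw [map_zero, smul_zero]
  simpa [map_one] using h

/-- The power series `∑ j, A_{j+1} X ^ (j + 1)` of a finite family of operators. -/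
def lagSeries {p : ℕ} (A : Fin p → R) : PowerSeries R :=
  ∑ j : Fin p, C (A j) * X ^ ((j : ℕ) + 1)

theorem coeff_lagSeries {p : ℕ} (A : Fin p → R) (n : ℕ) :
    coeff n (lagSeries A) = ∑ j : Fin p, if n = (j : ℕ) + 1 then A j else 0 := by
  simp [lagSeries, coeff_X_pow]

theorem coeff_lagSeries_mul {p : ℕ} (A : Fin p → R) (f : PowerSeries R)
    (n : ℕ) : coeff n (lagSeries A * f) =
      ∑ j : Fin p, if (j : ℕ) + 1 ≤ n then A j * coeff (n - (j + 1)) f else 0 := by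
  simp [lagSeries, Finset.sum_mul, mul_assoc, coeff_X_pow_mul']

theorem hasSum_symbol_lagSeries {p : ℕ} (A : Fin p → R) (z : ℂ) :
    HasSum (fun n => z ^ n • φ (coeff n (lagSeries A)))
      (∑ j : Fin p, z ^ ((j : ℕ) + 1) • φ (A j)) := by
  have h : ∀ n, z ^ n • φ (coeff n (lagSeries A)) =
      ∑ j : Fin p, z ^ n • φ (if n = (j : ℕ) + 1 then A j else 0) := by
    intro n
    rw [coeff_lagSeries, map_sum, Finset.smul_sum]
  simp_rw [h]
  refine hasSum_sum fun j _ => ?_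
  have h := hasSum_single (f := fun n => z ^ n • φ (if n = (j : ℕ) + 1 then A j else 0))
    ((j : ℕ) + 1) fun n hn => by
      rw [if_neg hn, map_zero, smul_zero]
  simpa using h

theorem summable_norm_coeff_lagSeries {p : ℕ} (A : Fin p → R) :
    Summable fun n => ‖coeff n (lagSeries A)‖ := by
  refine summable_of_hasFiniteSupport ((Finset.range (p + 1)).finite_toSet.subset fun n hn => ?_)
  by_contra hlt
  refine hn ?_
  change ‖coeff n (lagSeries A)‖ = 0
  rw [coeff_lagSeries, Finset.sum_eq_zero, norm_zero]
  intro j _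
  rw [if_neg]
  rintro rfl
  exact hlt (by simp)

theorem summable_norm_coeff_one : Summable fun n => ‖coeff n (1 : PowerSeries R)‖ := by
  refine summable_of_hasFiniteSupport ((Set.finite_singleton 0).subset fun n hn => ?_)
  by_contra h0
  refine hn ?_
  change ‖coeff n (1 : PowerSeries R)‖ = 0
  rw [coeff_one, if_neg (by simpa using h0), norm_zero]

theorem symbol_one (z : ℂ) : symbol φ (1 : PowerSeries R) z = 1 :=
  (hasSum_symbol_one φ z).tsum_eq

theorem symbol_one_sub_lagSeries {p : ℕ} (A : Fin p → R) (z : ℂ) :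
    symbol φ (1 - lagSeries A) z = 1 - ∑ j : Fin p, z ^ ((j : ℕ) + 1) • φ (A j) := by
  refine HasSum.tsum_eq ?_
  convert! (hasSum_symbol_one φ z).sub (hasSum_symbol_lagSeries φ A z) using 2 with n
  rw [map_sub, map_sub, smul_sub]

theorem symbol_one_add_lagSeries {q : ℕ} (B : Fin q → R) (z : ℂ) :
    symbol φ (1 + lagSeries B) z = 1 + ∑ j : Fin q, z ^ ((j : ℕ) + 1) • φ (B j) := by
  refine HasSum.tsum_eq ?_
  convert! (hasSum_symbol_one φ z).add (hasSum_symbol_lagSeries φ B z) using 2 with n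
  rw [map_add, map_add, smul_add]

theorem summable_norm_coeff_one_add_lagSeries {p : ℕ} (A : Fin p → R) :
    Summable fun n => ‖coeff n (1 + lagSeries A)‖ :=
  Summable.of_nonneg_of_le (fun _ => norm_nonneg _)
    (fun n => by rw [map_add]; exact norm_add_le _ _)
    (summable_norm_coeff_one.add (summable_norm_coeff_lagSeries A))

theorem summable_norm_coeff_one_sub_lagSeries {p : ℕ} (A : Fin p → R) :
    Summable fun n => ‖coeff n (1 - lagSeries A)‖ :=
  Summable.of_nonneg_of_le (fun _ => norm_nonneg _)
    (fun n => by rw [map_sub]; exact norm_sub_le _ _)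
    (summable_norm_coeff_one.add (summable_norm_coeff_lagSeries A))

/-- The inverse of the autoregressive power series `1 - ∑ j, A_j X ^ j`. -/
def arInverse {p : ℕ} (A : Fin p → R) : PowerSeries R :=
  invOfUnit (1 - lagSeries A) 1

theorem constantCoeff_lagSeries {p : ℕ} (A : Fin p → R) :
    constantCoeff (lagSeries A) = 0 := by
  simp [lagSeries]

theorem mul_arInverse {p : ℕ} (A : Fin p → R) :
    (1 - lagSeries A) * arInverse A = 1 :=
  mul_invOfUnit _ _ (by simp [constantCoeff_lagSeries])

theorem arInverse_mul {p : ℕ} (A : Fin p → R) :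
    arInverse A * (1 - lagSeries A) = 1 :=
  invOfUnit_mul _ _ (by simp [constantCoeff_lagSeries])

theorem coeff_zero_arInverse {p : ℕ} (A : Fin p → R) : coeff 0 (arInverse A) = 1 := by
  simp [arInverse]

/-- The recursion for the coefficients of `𝓐(z)⁻¹`, which is that of the companion operator. -/
theorem coeff_succ_arInverse {p : ℕ} (A : Fin p → R) (n : ℕ) :
    coeff (n + 1) (arInverse A) =
      ∑ j : Fin p, if (j : ℕ) ≤ n then A j * coeff (n - j) (arInverse A) else 0 := by
  have h := congrArg (coeff (n + 1)) (mul_arInverse A)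
  rw [sub_mul, one_mul, map_sub, coeff_lagSeries_mul, coeff_one, if_neg (by omega),
    sub_eq_zero] at h
  rw [h]
  refine Finset.sum_congr rfl fun j _ => ?_
  simp only [add_le_add_iff_right, Nat.reduceSubDiff]

theorem norm_exp_neg_I_mul (ω : ℝ) : ‖Complex.exp (-Complex.I * ω)‖ = 1 := by
  have := norm_exp_I_int_mul (-1) ω
  push_cast at this
  rwa [mul_neg_one] at this

theorem continuous_symbol [CompleteSpace 𝓐] (hφ : ∀ T, ‖φ T‖ ≤ ‖T‖) {f : PowerSeries R}
    (hf : Summable fun n => ‖coeff n f‖) :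
    Continuous fun ω : ℝ => symbol φ f (Complex.exp (-Complex.I * ω)) := by
  unfold symbol
  refine continuous_tsum (fun n => by fun_prop) hf fun n ω => ?_
  exact norm_symbol_term_le φ hφ f (norm_exp_neg_I_mul ω) n

section Inverse

variable [CompleteSpace 𝓐] {p : ℕ} {A : Fin p → R} {z : ℂ}

theorem symbol_arInverse_mul (hφ : ∀ T, ‖φ T‖ ≤ ‖T‖)
    (hA : Summable fun n => ‖coeff n (arInverse A)‖) (hz : ‖z‖ = 1) :
    symbol φ (arInverse A) z * (1 - ∑ j : Fin p, z ^ ((j : ℕ) + 1) • φ (A j)) = 1 := by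
  rw [← symbol_one_sub_lagSeries, ← symbol_mul φ hφ hA
    (summable_norm_coeff_one_sub_lagSeries A) hz, arInverse_mul, symbol_one]

theorem mul_symbol_arInverse (hφ : ∀ T, ‖φ T‖ ≤ ‖T‖)
    (hA : Summable fun n => ‖coeff n (arInverse A)‖) (hz : ‖z‖ = 1) :
    (1 - ∑ j : Fin p, z ^ ((j : ℕ) + 1) • φ (A j)) * symbol φ (arInverse A) z = 1 := by
  rw [← symbol_one_sub_lagSeries, ← symbol_mul φ hφ (summable_norm_coeff_one_sub_lagSeries A)
    hA hz, mul_arInverse, symbol_one]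

theorem isUnit_one_sub_sum (hφ : ∀ T, ‖φ T‖ ≤ ‖T‖)
    (hA : Summable fun n => ‖coeff n (arInverse A)‖) (hz : ‖z‖ = 1) :
    IsUnit (1 - ∑ j : Fin p, z ^ ((j : ℕ) + 1) • φ (A j)) :=
  ⟨⟨_, _, mul_symbol_arInverse φ hφ hA hz, symbol_arInverse_mul φ hφ hA hz⟩, rfl⟩

theorem ringInverse_one_sub_sum (hφ : ∀ T, ‖φ T‖ ≤ ‖T‖)
    (hA : Summable fun n => ‖coeff n (arInverse A)‖) (hz : ‖z‖ = 1) :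
    Ring.inverse (1 - ∑ j : Fin p, z ^ ((j : ℕ) + 1) • φ (A j)) = symbol φ (arInverse A) z :=
  Ring.inverse_unit ⟨_, _, mul_symbol_arInverse φ hφ hA hz, symbol_arInverse_mul φ hφ hA hz⟩

end Inverse

/-- The power series `𝓐(z)⁻¹ 𝓑(z)` of the causal FARMA filter. -/
def farmaSeries {p q : ℕ} (A : Fin p → R) (B : Fin q → R) : PowerSeries R :=
  arInverse A * (1 + lagSeries B)

theorem summable_norm_coeff_farmaSeries {p q : ℕ} {A : Fin p → R}
    (hA : Summable fun n => ‖coeff n (arInverse A)‖) (B : Fin q → R) :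
    Summable fun n => ‖coeff n (farmaSeries A B)‖ :=
  summable_norm_coeff_mul hA (summable_norm_coeff_one_add_lagSeries B)

theorem symbol_farmaSeries_sandwich [CompleteSpace 𝓐] [StarRing 𝓐] (hφ : ∀ T, ‖φ T‖ ≤ ‖T‖)
    {p q : ℕ} {A : Fin p → R} (hA : Summable fun n => ‖coeff n (arInverse A)‖) (B : Fin q → R)
    (S : 𝓐) {z : ℂ} (hz : ‖z‖ = 1) :
    Ring.inverse (1 - ∑ j : Fin p, z ^ ((j : ℕ) + 1) • φ (A j)) *
        (1 + ∑ j : Fin q, z ^ ((j : ℕ) + 1) • φ (B j)) * S *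
        star (1 + ∑ j : Fin q, z ^ ((j : ℕ) + 1) • φ (B j)) *
        Ring.inverse (star (1 - ∑ j : Fin p, z ^ ((j : ℕ) + 1) • φ (A j))) =
      symbol φ (farmaSeries A B) z * S * star (symbol φ (farmaSeries A B) z) := by
  rw [Ring.inverse_star, ringInverse_one_sub_sum φ hφ hA hz, farmaSeries,
    symbol_mul φ hφ hA (summable_norm_coeff_one_add_lagSeries B) hz, symbol_one_add_lagSeries,
    star_mul]
  simp only [mul_assoc]

end PowerSeriesCalculus

/-! ### The companion operator -/

section Companion

open PowerSeries

variable {H : Type*} [NormedAddCommGroup H] [InnerProductSpace ℝ H]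

theorem companion_apply {p : ℕ} (A : Fin p → H →L[ℝ] H) (x : PiLp 2 fun _ : Fin p => H)
    (i : Fin p) : companion A x i =
      if (i : ℕ) = 0 then ∑ j : Fin p, A j (x j) else x ⟨(i : ℕ) - 1, by omega⟩ := by
  simp only [companion]
  split_ifs with h <;> simp [h]

/-- The columns of the powers of the companion operator consist of coefficients of the inverse
of the autoregressive power series. -/
theorem companion_pow_single_apply {p : ℕ} (A : Fin p → H →L[ℝ] H) (hp : 0 < p) (x : H) (n : ℕ)
    (i : Fin p) : (companion A ^ n) (WithLp.toLp 2 (Pi.single ⟨0, hp⟩ x)) i =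
      if (i : ℕ) ≤ n then coeff (n - i) (arInverse A) x else 0 := by
  induction n generalizing i with
  | zero =>
    by_cases hi : i = ⟨0, hp⟩
    · subst hi
      simp [coeff_zero_arInverse]
    · have : ¬ (i : ℕ) ≤ 0 := fun h => hi (Fin.ext (by simpa using h))
      simp [hi, this]
  | succ n ih =>
    rw [pow_succ', mul_apply_eq_comp, companion_apply]
    split_ifs with h0 h1 h1
    · rw [h0, Nat.sub_zero, coeff_succ_arInverse, sum_apply]
      refine Finset.sum_congr rfl fun j _ => ?_
      rw [ih]
      split_ifs <;> simp
    · omega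
    · rw [ih, if_pos (by simp; omega)]
      congr 3
      simp
      omega
    · rw [ih, if_neg (by simp; omega)]

/-- Comparison with a geometric series along each residue class modulo `j`. The norm of `1` is not
assumed to be one, since the ring may be trivial; for `j = 0` the hypothesis forces this. -/
theorem summable_norm_pow_of_norm_pow_lt_one {R : Type*} [NormedRing R] (T : R) {j : ℕ}
    (h : ‖T ^ j‖ < 1) : Summable fun n => ‖T ^ n‖ := by
  rcases Nat.eq_zero_or_pos j with rfl | hj
  · rw [pow_zero] at h
    have h1 : ‖(1 : R)‖ = 0 := by
      have := norm_mul_le (1 : R) 1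
      rw [mul_one] at this
      nlinarith [norm_nonneg (1 : R)]
    have h2 : ∀ n, ‖T ^ n‖ = 0 := fun n => by
      rw [← one_mul (T ^ n)]
      refine le_antisymm ((norm_mul_le _ _).trans ?_) (norm_nonneg _)
      rw [h1, zero_mul]
    simp only [h2]
    exact summable_zero
  · have : NeZero j := ⟨hj.ne'⟩
    rw [← (Nat.divModEquiv j).symm.summable_iff]
    have hle : ∀ x : ℕ × Fin j, ‖T ^ ((Nat.divModEquiv j).symm x)‖ ≤
        (‖(1 : R)‖ + 1) * ‖T ^ j‖ ^ x.1 * ‖T ^ (x.2 : ℕ)‖ := by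
      intro x
      have hx : (Nat.divModEquiv j).symm x = j * x.1 + x.2 := by
        simp [Nat.divModEquiv, mul_comm]
      rw [hx, pow_add, pow_mul]
      refine (norm_mul_le _ _).trans ?_
      gcongr
      rcases Nat.eq_zero_or_pos x.1 with h0 | h0
      · rw [h0, pow_zero, pow_zero]; linarith
      · refine (norm_pow_le' _ h0).trans ?_
        refine le_mul_of_one_le_left (by positivity) (by linarith [norm_nonneg (1 : R)])
    refine Summable.of_nonneg_of_le (fun _ => norm_nonneg _) hle ?_
    have hg : Summable fun n => (‖(1 : R)‖ + 1) * ‖T ^ j‖ ^ n :=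
      (summable_geometric_of_lt_one (norm_nonneg _) h).mul_left _
    exact hg.mul_of_nonneg (g := fun r : Fin j => ‖T ^ (r : ℕ)‖) (Summable.of_finite)
      (fun _ => by positivity) fun _ => norm_nonneg _

/-- Under the stability condition `𝓐(z)⁻¹` has absolutely summable coefficients: they are corner
blocks of the powers of the companion operator. -/
theorem summable_norm_coeff_arInverse {p : ℕ} {A : Fin p → H →L[ℝ] H}
    (hA : StabilityCondition A) : Summable fun n => ‖coeff n (arInverse A)‖ := by
  obtain ⟨j₀, hj⟩ := hA
  rcases Nat.eq_zero_or_pos p with rfl | hp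
  · have : arInverse A = 1 := by
      have h := mul_arInverse A
      simpa [lagSeries] using h
    rw [this]
    exact summable_norm_coeff_one
  refine Summable.of_nonneg_of_le (fun _ => norm_nonneg _) (fun n => ?_)
    (summable_norm_pow_of_norm_pow_lt_one (companion A) hj)
  refine ContinuousLinearMap.opNorm_le_bound _ (norm_nonneg (companion A ^ n)) fun x => ?_
  have h := companion_pow_single_apply A hp x n ⟨0, hp⟩
  simp only [zero_le, if_true, Nat.sub_zero] at h
  rw [← h]
  refine (PiLp.norm_apply_le _ _).trans ((ContinuousLinearMap.le_opNorm _ _).trans ?_)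
  exact (congrArg _ (PiLp.norm_single 2 (fun _ : Fin p => H) ⟨0, hp⟩ x)).le

end Companion

/-! ### The complexification of an operator -/

section ComplexificationMap

variable {H : Type*} [NormedAddCommGroup H] [InnerProductSpace ℝ H] [CompleteSpace H]

namespace Complexification

theorem norm_map_le (T : H →L[ℝ] H) : ‖map T‖ ≤ ‖T‖ :=
  LinearMap.mkContinuous_norm_le _ (norm_nonneg _) _

@[simp] theorem re_real_smul (c : ℝ) (z : Complexification H) : (c • z).re = c • z.re := by
  change ((c : ℂ) • z).re = _
  rw [re_smul]
  simp

@[simp] theorem im_real_smul (c : ℝ) (z : Complexification H) : (c • z).im = c • z.im := by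
  change ((c : ℂ) • z).im = _
  rw [im_smul]
  simp

/-- `Complexification.map` as a ring homomorphism. -/
def mapRingHom : (H →L[ℝ] H) →+* (Complexification H →L[ℂ] Complexification H) where
  toFun := map
  map_zero' := by ext z <;> simp
  map_one' := by ext z <;> simp
  map_add' S T := by ext z <;> simp
  map_mul' S T := by ext z <;> simp

theorem map_smul_real (c : ℝ) (T : H →L[ℝ] H) : map (c • T) = (c : ℂ) • map T := by
  ext z <;> simp

theorem inner_eq (z w : Complexification H) : inner ℂ z w =
    (⟨inner ℝ z.re w.re + inner ℝ z.im w.im, inner ℝ z.re w.im - inner ℝ z.im w.re⟩ : ℂ) :=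
  rfl

theorem adjoint_map (T : H →L[ℝ] H) :
    ContinuousLinearMap.adjoint (map T) = map (ContinuousLinearMap.adjoint T) := by
  symm
  rw [ContinuousLinearMap.eq_adjoint_iff]
  intro z w
  rw [inner_eq, inner_eq]
  simp [ContinuousLinearMap.adjoint_inner_left]

end Complexification

open Complexification

variable {p q : ℕ} {A : Fin p → H →L[ℝ] H}

theorem isUnit_arPoly (hA : StabilityCondition A) {z : ℂ} (hz : ‖z‖ = 1) : IsUnit (arPoly A z) :=
  isUnit_one_sub_sum (𝓐 := Complexification H →L[ℂ] Complexification H) mapRingHom norm_map_le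
    (summable_norm_coeff_arInverse hA) hz

/-- The FARMA spectral density is the sandwich of `S` by the symbol of the causal filter. -/
theorem farmaSpectralDensity_eq (hA : StabilityCondition A) (B : Fin q → H →L[ℝ] H)
    (S : H →L[ℝ] H) (ω : ℝ) :
    farmaSpectralDensity A B S ω = ((2 * Real.pi : ℝ) : ℂ)⁻¹ •
      (symbol mapRingHom (farmaSeries A B) (Complex.exp (-Complex.I * ω)) *
        Complexification.map S * ContinuousLinearMap.adjoint
          (symbol mapRingHom (farmaSeries A B) (Complex.exp (-Complex.I * ω)))) := by
  have h := symbol_farmaSeries_sandwich (𝓐 := Complexification H →L[ℂ] Complexification H)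
    mapRingHom norm_map_le (summable_norm_coeff_arInverse hA) B (Complexification.map S)
    (norm_exp_neg_I_mul ω)
  exact congrArg (((2 * Real.pi : ℝ) : ℂ)⁻¹ • ·) h

end ComplexificationMap

/-! ### Trace-class sandwiches of a covariance operator -/

section Sandwich

variable {E : Type*} [NormedAddCommGroup E] [InnerProductSpace ℂ E]

/-- The Cauchy–Schwarz inequality combined with Bessel's inequality for `e` and `f`. -/
theorem sum_enorm_inner_mul_le {n : ℕ} {e f : Fin n → E} (he : Orthonormal ℂ e)
    (hf : Orthonormal ℂ f) (x y : E) :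
    ∑ i, ‖inner ℂ (f i) x * inner ℂ y (e i)‖ₑ ≤ ‖x‖ₑ * ‖y‖ₑ := by
  have h1 : ∑ i, ‖inner ℂ (f i) x‖ * ‖inner ℂ (e i) y‖ ≤ ‖x‖ * ‖y‖ := by
    refine (Real.sum_mul_le_sqrt_mul_sqrt _ _ _).trans ?_
    gcongr
    · exact Real.sqrt_le_iff.2 ⟨norm_nonneg _, hf.sum_inner_products_le x⟩
    · exact Real.sqrt_le_iff.2 ⟨norm_nonneg _, he.sum_inner_products_le y⟩
  simp only [← ofReal_norm]
  rw [← ENNReal.ofReal_mul (norm_nonneg _), ← ENNReal.ofReal_sum_of_nonneg fun _ _ => norm_nonneg _]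
  refine ENNReal.ofReal_le_ofReal (le_trans (le_of_eq ?_) h1)
  refine Finset.sum_congr rfl fun i _ => ?_
  rw [norm_mul, norm_inner_symm y]

variable [CompleteSpace E] {Ω : Type*} [MeasurableSpace Ω] {P : Measure Ω} {x : Ω → E}
  {T : E →L[ℂ] E}

/-- If `T` is the covariance operator of `x`, Bessel's inequality under the expectation bounds the
trace norm of `C T D^*`. -/
theorem traceNorm_sandwich_le (hx : AEStronglyMeasurable x P)
    (hT : ∀ u v, inner ℂ u (T v) = ∫ ω, inner ℂ u (x ω) * inner ℂ (x ω) v ∂P)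
    (C D : E →L[ℂ] E) : traceNorm (C * T * ContinuousLinearMap.adjoint D) ≤
      ‖C‖ₑ * ‖D‖ₑ * ∫⁻ ω, ‖x ω‖ₑ ^ 2 ∂P := by
  refine traceNorm_le fun n e f he hf => ?_
  have h1 : ∀ i, ‖inner ℂ (f i) ((C * T * ContinuousLinearMap.adjoint D) (e i))‖ₑ ≤
      ∫⁻ ω, ‖inner ℂ (f i) (C (x ω)) * inner ℂ (D (x ω)) (e i)‖ₑ ∂P := by
    intro i
    have : inner ℂ (f i) ((C * T * ContinuousLinearMap.adjoint D) (e i)) =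
        ∫ ω, inner ℂ (f i) (C (x ω)) * inner ℂ (D (x ω)) (e i) ∂P := by
      rw [mul_apply_eq_comp, mul_apply_eq_comp, ← ContinuousLinearMap.adjoint_inner_left, hT]
      simp only [ContinuousLinearMap.adjoint_inner_left, ContinuousLinearMap.adjoint_inner_right]
    rw [this]
    exact enorm_integral_le_lintegral_enorm _
  refine (Finset.sum_le_sum fun i _ => h1 i).trans ?_
  have hC := C.continuous.comp_aestronglyMeasurable hx
  have hD := D.continuous.comp_aestronglyMeasurable hx
  have hm : ∀ i, AEMeasurable (fun ω => ‖inner ℂ (f i) (C (x ω)) * inner ℂ (D (x ω)) (e i)‖ₑ) P :=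
    fun i => ((aestronglyMeasurable_const.inner hC).mul (hD.inner aestronglyMeasurable_const)).enorm
  rw [← lintegral_finsetSum' _ fun i _ => hm i, ← lintegral_const_mul'']
  · refine lintegral_mono fun ω => (sum_enorm_inner_mul_le he hf _ _).trans ?_
    calc ‖C (x ω)‖ₑ * ‖D (x ω)‖ₑ ≤ (‖C‖ₑ * ‖x ω‖ₑ) * (‖D‖ₑ * ‖x ω‖ₑ) := by
          gcongr <;> exact ContinuousLinearMap.le_opENorm _ _
      _ = ‖C‖ₑ * ‖D‖ₑ * ‖x ω‖ₑ ^ 2 := by ring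
  · exact hx.enorm.pow_const 2

/-- The trace-class operator `C T C^*`. -/
def sandwich (T : E →L[ℂ] E) {K : ℝ≥0∞} (hK : K ≠ ∞)
    (hT : ∀ C D : E →L[ℂ] E,
      traceNorm (C * T * ContinuousLinearMap.adjoint D) ≤ ‖C‖ₑ * ‖D‖ₑ * K)
    (C : E →L[ℂ] E) : TraceClass E :=
  ⟨C * T * ContinuousLinearMap.adjoint C, lt_of_le_of_lt (hT C C)
    (ENNReal.mul_lt_top (ENNReal.mul_lt_top enorm_lt_top enorm_lt_top) hK.lt_top)⟩

theorem continuous_sandwich {K : ℝ≥0∞} (hK : K ≠ ∞)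
    (hT : ∀ C D : E →L[ℂ] E,
      traceNorm (C * T * ContinuousLinearMap.adjoint D) ≤ ‖C‖ₑ * ‖D‖ₑ * K) :
    Continuous (sandwich T hK hT) := by
  refine continuous_iff_continuousAt.2 fun C₀ => ?_
  rw [ContinuousAt, tendsto_iff_norm_sub_tendsto_zero]
  have hb : ∀ C, ‖sandwich T hK hT C - sandwich T hK hT C₀‖ ≤
      ‖C - C₀‖ * ‖C‖ * K.toReal + ‖C₀‖ * ‖C - C₀‖ * K.toReal := by
    intro C
    have h1 : (sandwich T hK hT C - sandwich T hK hT C₀).toCLM =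
        (C - C₀) * T * ContinuousLinearMap.adjoint C +
          C₀ * T * ContinuousLinearMap.adjoint (C - C₀) := by
      change C * T * ContinuousLinearMap.adjoint C - C₀ * T * ContinuousLinearMap.adjoint C₀ = _
      rw [map_sub]
      noncomm_ring
    have h2 : traceNorm (sandwich T hK hT C - sandwich T hK hT C₀).toCLM ≤
        ‖C - C₀‖ₑ * ‖C‖ₑ * K + ‖C₀‖ₑ * ‖C - C₀‖ₑ * K := by
      rw [h1]
      exact (traceNorm_add_le _ _).trans (add_le_add (hT _ _) (hT _ _))
    have hne : ∀ a b : E →L[ℂ] E, ‖a‖ₑ * ‖b‖ₑ * K ≠ ∞ := fun a b =>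
      ENNReal.mul_ne_top (ENNReal.mul_ne_top enorm_ne_top enorm_ne_top) hK
    have h3 := ENNReal.toReal_mono (ENNReal.add_ne_top.2 ⟨hne _ _, hne _ _⟩) h2
    rw [ENNReal.toReal_add (hne _ _) (hne _ _)] at h3
    simpa only [ENNReal.toReal_mul, toReal_enorm, TraceClass.norm_def] using h3
  refine squeeze_zero (fun _ => norm_nonneg _) hb ?_
  have hc : Continuous fun C : E →L[ℂ] E =>
      ‖C - C₀‖ * ‖C‖ * K.toReal + ‖C₀‖ * ‖C - C₀‖ * K.toReal := by fun_prop
  simpa using hc.tendsto C₀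

theorem memLp_smul_continuous {F : Type*} [NormedAddCommGroup F] [NormedSpace ℂ F] {s : ℝ → ℝ}
    (hs : IntervalIntegrable s volume 0 (2 * Real.pi)) {G : ℝ → F} (hG : Continuous G) :
    MemLp (fun ω => ((s ω : ℝ) : ℂ) • G ω) 1 (volume.restrict (Set.Icc 0 (2 * Real.pi))) := by
  rw [memLp_one_iff_integrable]
  have hs' : IntegrableOn s (Set.Icc 0 (2 * Real.pi)) :=
    (intervalIntegrable_iff_integrableOn_Icc_of_le (by positivity)).1 hs
  exact IntegrableOn.smul_continuousOn (𝕜 := ℂ) (f := fun ω => (s ω : ℂ)) hs'.ofReal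
    hG.continuousOn isCompact_Icc

end Sandwich

/-! ### Autocovariances of a linear filter -/

section FilterCovariance

variable {a : ℤ → ℝ}

theorem tsum_abs_mul_shift_le (ha : Summable fun k => a k ^ 2) (m n : ℤ) :
    ∑' l, |a (l + m) * a (l + n)| ≤ ∑' l, a l ^ 2 := by
  have hsh : ∀ m : ℤ, HasSum (fun l : ℤ => a (l + m) ^ 2) (∑' l, a l ^ 2) := fun m =>
    (Equiv.addRight m).hasSum_iff (f := fun l => a l ^ 2) |>.2 ha.hasSum
  have h := ((hsh m).add (hsh n)).mul_left (1 / 2)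
  have hle := (summable_mul_shift ha m n).tsum_le_tsum (fun l => ?_) h.summable
  · refine hle.trans (le_of_eq ?_)
    rw [h.tsum_eq]
    ring
  · rw [abs_mul, ← sq_abs (a (l + m)), ← sq_abs (a (l + n))]
    nlinarith [sq_nonneg (|a (l + m)| - |a (l + n)|)]

theorem abs_le_of_summable_sq (ha : Summable fun k => a k ^ 2) (k : ℤ) :
    |a k| ≤ 1 + ∑' l, a l ^ 2 := by
  have h := ha.le_tsum k fun _ _ => sq_nonneg _
  rw [← sq_abs] at h
  nlinarith [sq_nonneg (|a k| - 1), abs_nonneg (a k)]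

variable {R : Type*} [NormedRing R] [NormedAlgebra ℝ R]

/-- The impulse response of the composition of a scalar filter `a` with an operator filter `f`. -/
def filterCoeff (a : ℤ → ℝ) (f : ℕ → R) (k : ℤ) : R := ∑' i : ℕ, a (k - i) • f i

theorem summable_norm_filterCoeff_term (ha : Summable fun k => a k ^ 2) {f : ℕ → R}
    (hf : Summable fun n => ‖f n‖) (k : ℤ) : Summable fun i : ℕ => ‖a (k - i) • f i‖ := by
  refine Summable.of_nonneg_of_le (fun _ => norm_nonneg _) (fun i => ?_)
    (hf.mul_left (1 + ∑' l, a l ^ 2))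
  rw [norm_smul, Real.norm_eq_abs]
  gcongr
  exact abs_le_of_summable_sq ha _

/-- The autocovariance `∑ l, a (l + m) a l` of a scalar filter. -/
def scalarAutocov (a : ℤ → ℝ) (m : ℤ) : ℝ := ∑' l : ℤ, a (l + m) * a l

theorem abs_scalarAutocov_le (ha : Summable fun k => a k ^ 2) (m : ℤ) :
    |scalarAutocov a m| ≤ ∑' l, a l ^ 2 := by
  have h := summable_mul_shift ha m 0
  have h2 := tsum_abs_mul_shift_le ha m 0
  simp only [add_zero, ← Real.norm_eq_abs] at h h2
  rw [← Real.norm_eq_abs, scalarAutocov]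
  exact (norm_tsum_le_tsum_norm h).trans h2

variable [CompleteSpace R] [StarRing R] [NormedStarGroup R] [StarModule ℝ R]

theorem summable_norm_sandwich {f : ℕ → R} (hf : Summable fun n => ‖f n‖) (S : R) :
    Summable fun x : ℕ × ℕ => ‖f x.1 * S * star (f x.2)‖ := by
  refine Summable.of_nonneg_of_le (fun _ => norm_nonneg _) (fun x => ?_)
    ((hf.mul_right ‖S‖).mul_of_nonneg hf (fun _ => by positivity) fun _ => norm_nonneg _)
  refine (norm_mul_le _ _).trans ?_
  rw [norm_star]
  gcongr
  exact norm_mul_le _ _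

/-- The autocovariances of a composed filter: by absolute convergence they are obtained by
smoothing the autocovariances of the scalar filter with the operator filter. -/
theorem hasSum_filterCoeff_sandwich (ha : Summable fun k => a k ^ 2) {f : ℕ → R}
    (hf : Summable fun n => ‖f n‖) (S : R) (h : ℤ) :
    HasSum (fun k : ℤ => filterCoeff a f (k + h) * S * star (filterCoeff a f k))
      (∑' x : ℕ × ℕ, scalarAutocov a (h + x.2 - x.1) • (f x.1 * S * star (f x.2))) := by
  set G : (ℕ × ℕ) × ℤ → R := fun x =>
    (a (x.2 + h - x.1.1) * a (x.2 - x.1.2)) • (f x.1.1 * S * star (f x.1.2)) with hG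
  have hf2 := summable_norm_sandwich hf S
  have hshift : ∀ x : ℕ × ℕ, ∀ k : ℤ, a (k + h - x.1) * a (k - x.2) =
      a (k + (h - x.1)) * a (k + (-x.2)) := fun x k => by
    rw [add_sub_assoc, sub_eq_add_neg k]
  have hGn : Summable fun x => ‖G x‖ := by
    rw [summable_prod_of_nonneg fun _ => norm_nonneg _]
    simp only [hG, norm_smul, Real.norm_eq_abs]
    constructor
    · intro x
      refine Summable.mul_right _ ?_
      simp only [hshift x]
      exact summable_mul_shift ha _ _
    · simp only [tsum_mul_right]
      refine Summable.of_nonneg_of_le (fun x => mul_nonneg (tsum_nonneg fun _ => abs_nonneg _)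
        (norm_nonneg _)) (fun x => ?_) (hf2.mul_left (∑' l, a l ^ 2))
      refine mul_le_mul_of_nonneg_right ?_ (norm_nonneg _)
      simp only [hshift x]
      exact tsum_abs_mul_shift_le ha _ _
  have hGs : Summable G := hGn.of_norm
  have hrow : ∀ x : ℕ × ℕ, HasSum (fun k => G (x, k))
      (scalarAutocov a (h + x.2 - x.1) • (f x.1 * S * star (f x.2))) := by
    intro x
    simp only [hG]
    refine HasSum.smul_const ?_ _
    have h1 : HasSum (fun l => a (l + (h + x.2 - x.1)) * a l) (scalarAutocov a (h + x.2 - x.1)) := by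
      have h2 := (summable_mul_shift ha (h + x.2 - x.1) 0).of_abs
      simp only [add_zero] at h2
      exact h2.hasSum
    rw [← (Equiv.subRight (x.2 : ℤ)).hasSum_iff] at h1
    convert! h1 using 2 with k
    simp only [Function.comp, Equiv.subRight_apply]
    congr 2
    ring
  have htot : HasSum G (∑' x : ℕ × ℕ, scalarAutocov a (h + x.2 - x.1) •
      (f x.1 * S * star (f x.2))) := by
    have h1 := hGs.hasSum
    rwa [← (h1.prod_fiberwise hrow).tsum_eq] at h1
  have hcol : ∀ k : ℤ, HasSum (fun x => G (x, k))
      (filterCoeff a f (k + h) * S * star (filterCoeff a f k)) := by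
    intro k
    have hs := hGs.comp_injective (i := fun x : ℕ × ℕ => (x, k)) fun x y hxy => by
      simpa using hxy
    have h1 := (summable_norm_filterCoeff_term ha hf (k + h))
    have h1' : Summable fun i : ℕ => ‖a (k + h - i) • f i * S‖ :=
      Summable.of_nonneg_of_le (fun _ => norm_nonneg _) (fun _ => norm_mul_le _ _)
        (h1.mul_right ‖S‖)
    have h2 := (summable_norm_filterCoeff_term ha hf k)
    have h2' : Summable fun i : ℕ => ‖star (a (k - i) • f i)‖ := by simpa only [norm_star] using h2
    have h3 : filterCoeff a f (k + h) * S * star (filterCoeff a f k) = ∑' x, G (x, k) := by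
      unfold filterCoeff
      rw [← h1.of_norm.tsum_mul_right, tsum_star, tsum_mul_tsum_of_summable_norm h1' h2']
      refine tsum_congr fun x => ?_
      simp only [hG, star_smul, star_trivial, smul_mul_assoc, mul_smul_comm, smul_smul]
      rw [mul_comm (a (k - x.2))]
    rw [h3]
    exact hs.hasSum
  have hswap := (Equiv.prodComm ℤ (ℕ × ℕ)).hasSum_iff (f := G) |>.2 htot
  exact hswap.prod_fiberwise hcol

variable {𝓐 : Type*} [NormedRing 𝓐] [NormedAlgebra ℂ 𝓐] [CompleteSpace 𝓐] [StarRing 𝓐]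
  [NormedStarGroup 𝓐] [StarModule ℂ 𝓐] (φ : R →+* 𝓐)

/-- The double series of `Ψ(z) S Ψ(z)^*` at `z = exp (-i ω)`. -/
theorem hasSum_symbol_sandwich (hφ : ∀ T, ‖φ T‖ ≤ ‖T‖) (hφs : ∀ T, φ (star T) = star (φ T))
    {f : PowerSeries R} (hf : Summable fun n => ‖PowerSeries.coeff n f‖) (S : R) (ω : ℝ) :
    HasSum (fun x : ℕ × ℕ => Complex.exp (Complex.I * (x.2 - x.1 : ℤ) * ω) •
        φ (PowerSeries.coeff x.1 f * S * star (PowerSeries.coeff x.2 f)))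
      (symbol φ f (Complex.exp (-Complex.I * ω)) * φ S *
        star (symbol φ f (Complex.exp (-Complex.I * ω)))) := by
  have hz := norm_exp_neg_I_mul ω
  have hf2 := summable_norm_sandwich hf S
  have hs : Summable fun x : ℕ × ℕ => Complex.exp (Complex.I * (x.2 - x.1 : ℤ) * ω) •
        φ (PowerSeries.coeff x.1 f * S * star (PowerSeries.coeff x.2 f)) := by
    refine Summable.of_norm (Summable.of_nonneg_of_le (fun _ => norm_nonneg _) (fun x => ?_) hf2)
    rw [norm_smul, norm_exp_I_int_mul, one_mul]
    exact hφ _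
  have h1 := summable_symbol_term φ hφ hf hz
  have h1' : Summable fun i : ℕ =>
      ‖Complex.exp (-Complex.I * ω) ^ i • φ (PowerSeries.coeff i f) * φ S‖ :=
    Summable.of_nonneg_of_le (fun _ => norm_nonneg _) (fun _ => norm_mul_le _ _)
      (h1.mul_right ‖φ S‖)
  have h2' : Summable fun i : ℕ =>
      ‖star (Complex.exp (-Complex.I * ω) ^ i • φ (PowerSeries.coeff i f))‖ := by
    simpa only [norm_star] using h1
  convert! hs.hasSum using 1
  unfold symbol
  rw [← h1.of_norm.tsum_mul_right, tsum_star, tsum_mul_tsum_of_summable_norm h1' h2']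
  refine tsum_congr fun x => ?_
  have hexp : Complex.exp (Complex.I * (x.2 - x.1 : ℤ) * ω) =
      star (Complex.exp (-Complex.I * ω) ^ x.2) * Complex.exp (-Complex.I * ω) ^ x.1 := by
    rw [← Complex.exp_nat_mul, ← Complex.exp_nat_mul, Complex.star_def, ← Complex.exp_conj,
      ← Complex.exp_add]
    congr 1
    simp
    ring
  rw [star_smul, hexp]
  simp only [smul_mul_assoc, mul_smul_comm, smul_smul, map_mul, hφs]

/-- The spectral representation of the autocovariances of a composed filter. -/
theorem map_tsum_filterCoeff_sandwich (hφ : ∀ T, ‖φ T‖ ≤ ‖T‖)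
    (hφs : ∀ T, φ (star T) = star (φ T)) (hφr : ∀ (c : ℝ) T, φ (c • T) = (c : ℂ) • φ T)
    (ha : Summable fun k => a k ^ 2) {s : ℝ → ℝ}
    (hs : IntervalIntegrable s volume 0 (2 * Real.pi))
    (has : ∀ m : ℤ, ∫ ω in (0 : ℝ)..(2 * Real.pi), (s ω : ℂ) * Complex.exp (Complex.I * m * ω) =
      (2 * Real.pi : ℝ) * (scalarAutocov a m : ℝ))
    {f : PowerSeries R} (hf : Summable fun n => ‖PowerSeries.coeff n f‖) (S : R) (h : ℤ) :
    φ (∑' k : ℤ, filterCoeff a (fun n => PowerSeries.coeff n f) (k + h) * S *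
        star (filterCoeff a (fun n => PowerSeries.coeff n f) k)) =
      ∫ ω in (0 : ℝ)..(2 * Real.pi), Complex.exp (Complex.I * h * ω) • (s ω : ℂ) •
        ((2 * Real.pi : ℝ) : ℂ)⁻¹ • (symbol φ f (Complex.exp (-Complex.I * ω)) * φ S *
          star (symbol φ f (Complex.exp (-Complex.I * ω)))) := by
  have h0 : (0 : ℝ) ≤ 2 * Real.pi := by positivity
  have hpi : ((2 * Real.pi : ℝ) : ℂ) ≠ 0 := by
    rw [Complex.ofReal_ne_zero]; positivity
  have hf2 := summable_norm_sandwich hf S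
  have hf3 : Summable fun x : ℕ × ℕ =>
      ‖φ (PowerSeries.coeff x.1 f * S * star (PowerSeries.coeff x.2 f))‖ :=
    Summable.of_nonneg_of_le (fun _ => norm_nonneg _) (fun x => hφ _) hf2
  rw [(hasSum_filterCoeff_sandwich ha hf S h).tsum_eq]
  have hcont : Continuous φ :=
    AddMonoidHomClass.continuous_of_bound φ 1 fun x => by rw [one_mul]; exact hφ x
  have hsl : Summable fun x : ℕ × ℕ => scalarAutocov a (h + x.2 - x.1) •
      (PowerSeries.coeff x.1 f * S * star (PowerSeries.coeff x.2 f)) := by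
    refine Summable.of_norm (Summable.of_nonneg_of_le (fun _ => norm_nonneg _) (fun x => ?_)
      (hf2.mul_left (∑' l, a l ^ 2)))
    rw [norm_smul, Real.norm_eq_abs]
    gcongr
    exact abs_scalarAutocov_le ha _
  rw [← (hsl.hasSum.map φ hcont).tsum_eq]
  set G : ℕ × ℕ → ℝ → 𝓐 := fun x ω =>
    ((s ω : ℂ) * Complex.exp (Complex.I * (h + x.2 - x.1 : ℤ) * ω) * ((2 * Real.pi : ℝ) : ℂ)⁻¹) •
      φ (PowerSeries.coeff x.1 f * S * star (PowerSeries.coeff x.2 f)) with hG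
  have hpt : ∀ ω : ℝ, Complex.exp (Complex.I * h * ω) • (s ω : ℂ) •
        ((2 * Real.pi : ℝ) : ℂ)⁻¹ • (symbol φ f (Complex.exp (-Complex.I * ω)) * φ S *
          star (symbol φ f (Complex.exp (-Complex.I * ω)))) = ∑' x, G x ω := by
    intro ω
    rw [smul_smul, smul_smul]
    refine (((hasSum_symbol_sandwich φ hφ hφs hf S ω).const_smul _).tsum_eq).symm.trans ?_
    refine tsum_congr fun x => ?_
    simp only [hG]
    rw [smul_smul, show h + x.2 - x.1 = h + (x.2 - x.1) by ring, ← exp_int_mul_mul]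
    congr 1
    ring
  have hval : ∀ x, ∫ ω in (0 : ℝ)..(2 * Real.pi), G x ω = φ (scalarAutocov a (h + x.2 - x.1) •
      (PowerSeries.coeff x.1 f * S * star (PowerSeries.coeff x.2 f))) := by
    intro x
    simp only [hG]
    rw [intervalIntegral.integral_smul_const, intervalIntegral.integral_mul_const, has, hφr]
    congr 1
    field_simp
  have hint : HasSum (fun x => ∫ ω in (0 : ℝ)..(2 * Real.pi), G x ω)
      (∫ ω in (0 : ℝ)..(2 * Real.pi), ∑' x, G x ω) := by
    simp only [intervalIntegral.integral_of_le h0]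
    have hsI : Integrable s (volume.restrict (Set.Ioc 0 (2 * Real.pi))) := hs.1
    refine MeasureTheory.hasSum_integral_of_summable_integral_norm (fun x => ?_) ?_
    · simp only [hG]
      refine Integrable.smul_const ?_ _
      refine Integrable.mul_const ?_ _
      refine hsI.ofReal.mul_bdd (c := 1) ?_ ?_
      · exact Continuous.aestronglyMeasurable (by fun_prop)
      · exact Eventually.of_forall fun ω => (norm_exp_I_int_mul _ ω).le
    · simp only [hG, norm_smul, norm_mul, norm_exp_I_int_mul, mul_one, Complex.norm_real]
      simp only [integral_mul_const]
      exact hf3.mul_left _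
  simp_rw [hpt]
  rw [← hint.tsum_eq]
  exact tsum_congr fun x => (hval x).symm

end FilterCovariance

/-! ### Measurability with respect to the past -/

section Past

theorem aestronglyMeasurable_fun_sum {Ω M ι : Type*} {m m₀ : MeasurableSpace Ω} {P : Measure[m₀] Ω}
    [AddCommMonoid M] [TopologicalSpace M] [ContinuousAdd M] (s : Finset ι) {f : ι → Ω → M}
    (hf : ∀ i ∈ s, AEStronglyMeasurable[m] (f i) P) :
    AEStronglyMeasurable[m] (fun ω => ∑ i ∈ s, f i ω) P := by
  classical
  induction s using Finset.induction_on with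
  | empty => simpa using aestronglyMeasurable_const
  | insert a s ha ih =>
    simp only [Finset.sum_insert ha]
    exact (hf a (Finset.mem_insert_self _ _)).add
      (ih fun i hi => hf i (Finset.mem_insert_of_mem hi))

/-- Measurability with respect to a sub-σ-algebra, up to null sets, passes to limits in `L²`. -/
theorem aestronglyMeasurable_of_tendsto_eLpNorm {Ω F : Type*} {m m₀ : MeasurableSpace Ω}
    {P : Measure[m₀] Ω} [NormedAddCommGroup F] [CompleteSpace F] (hm : m ≤ m₀) {f : ℕ → Ω → F}
    {g : Ω → F} (hf : ∀ n, AEStronglyMeasurable[m] (f n) P) (hg : AEStronglyMeasurable g P)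
    (h : Tendsto (fun n => eLpNorm (f n - g) 2 P) atTop (𝓝 0)) : AEStronglyMeasurable[m] g P := by
  obtain ⟨ns, -, hns⟩ := (tendstoInMeasure_of_tendsto_eLpNorm two_ne_zero
    (fun n => (hf n).mono hm) hg h).exists_seq_tendsto_ae
  refine ⟨fun ω => limUnder atTop fun i => (hf (ns i)).mk _ ω,
    @StronglyMeasurable.limUnder _ _ _ m _ _ _ _ _ _ _ fun i => (hf (ns i)).stronglyMeasurable_mk, ?_⟩
  have hall : ∀ᵐ ω ∂P, ∀ i, f (ns i) ω = (hf (ns i)).mk _ ω :=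
    ae_all_iff.2 fun i => (hf (ns i)).ae_eq_mk
  filter_upwards [hns, hall] with ω h1 h2
  simp only [h2] at h1
  exact h1.limUnder_eq.symm

variable {Ω : Type*} [mΩ : MeasurableSpace Ω] {H : Type*} [MeasurableSpace H] {ε : ℤ → Ω → H}

theorem past_le (hε : ∀ t, Measurable (ε t)) (t : ℤ) : past ε t ≤ mΩ :=
  iSup_le fun s => (hε s).comap_le

theorem past_mono {s t : ℤ} (hst : s ≤ t) : past ε s ≤ past ε t :=
  iSup_le fun r => le_iSup (fun r : {r : ℤ // r ≤ t} => MeasurableSpace.comap (ε r) inferInstance)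
    ⟨r.1, r.2.trans hst⟩

theorem comap_le_past {s t : ℤ} (hst : s ≤ t) :
    MeasurableSpace.comap (ε s) inferInstance ≤ past ε t :=
  le_iSup (fun r : {r : ℤ // r ≤ t} => MeasurableSpace.comap (ε r) inferInstance) ⟨s, hst⟩

theorem indep_past_comap {P : Measure Ω} (hε : ∀ t, Measurable (ε t)) (hi : iIndepFun ε P)
    {r s : ℤ} (hrs : r < s) :
    Indep (past ε r) (MeasurableSpace.comap (ε s) inferInstance) P := by
  have h := indep_iSup_of_disjoint (fun t => (hε t).comap_le) hi
    (S := Set.Iic r) (T := {s}) (by simpa using hrs)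
  rw [iSup_subtype'] at h
  simp only [Set.mem_singleton_iff, iSup_iSup_eq_left] at h
  exact h

/-- Kolmogorov's zero-one law: a centred variable in the remote past of the noise vanishes. -/
theorem ae_eq_zero_of_forall_past {P : Measure Ω} [IsProbabilityMeasure P]
    (hε : ∀ t, Measurable (ε t)) (hi : iIndepFun ε P) {t : ℤ} {f : Ω → ℝ}
    (hf : ∀ n : ℕ, AEStronglyMeasurable[past ε (t - n)] f P) (hint : Integrable f P)
    (h0 : ∫ ω, f ω ∂P = 0) : f =ᵐ[P] 0 := by
  have htail_eq : limsup (fun s => MeasurableSpace.comap (ε s) inferInstance) atBot =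
      ⨅ i : ℤ, past ε i := by
    rw [(atBot_basis (α := ℤ)).limsup_eq_iInf_iSup]
    simp only [iInf_true]
    exact iInf_congr fun i => iSup_subtype'
  have htail_le : ⨅ i : ℤ, past ε i ≤ mΩ := (iInf_le _ 0).trans (past_le hε 0)
  set g : Ω → ℝ := fun ω => limsup (fun n => (hf n).mk f ω) atTop with hg
  have hfg : f =ᵐ[P] g := by
    have hall : ∀ᵐ ω ∂P, ∀ n, f ω = (hf n).mk _ ω := ae_all_iff.2 fun n => (hf n).ae_eq_mk
    filter_upwards [hall] with ω hω
    simp only [hg, ← hω, limsup_const]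
  have hgm : Measurable[⨅ i : ℤ, past ε i] g := by
    rw [measurable_iff_comap_le]
    refine le_iInf fun i => ?_
    rw [← measurable_iff_comap_le]
    have hshift : g = fun ω => limsup (fun n => (hf (n + (t - i).toNat)).mk f ω) atTop := by
      ext ω
      exact (limsup_nat_add (fun n => (hf n).mk f ω) _).symm
    rw [hshift]
    refine Measurable.limsup fun n => ?_
    exact ((hf _).stronglyMeasurable_mk.measurable).mono (past_mono (by push_cast; omega)) le_rfl
  have hself := indep_limsup_atBot_self (fun t => (hε t).comap_le) hi
  rw [htail_eq] at hself
  have h1 := condExp_indep_eq htail_le htail_le hgm.stronglyMeasurable hself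
  rw [condExp_of_stronglyMeasurable htail_le hgm.stronglyMeasurable (hint.congr hfg)] at h1
  filter_upwards [hfg, h1] with ω h2 h3
  rw [h2, h3, ← integral_congr_ae hfg, h0]
  rfl

end Past

/-! ### Causal inversion of a filter -/

section Inversion

open PowerSeries

variable {Ω : Type*} [MeasurableSpace Ω] {H : Type*} [NormedAddCommGroup H]
  [InnerProductSpace ℝ H] [CompleteSpace H] [TopologicalSpace.SeparableSpace H] [MeasurableSpace H]
  [BorelSpace H] {P : Measure Ω} {ε : ℤ → Ω → H}

theorem aestronglyMeasurable_noise_past {s t : ℤ} (hst : s ≤ t) :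
    AEStronglyMeasurable[past ε t] (ε s) P := by
  have : SecondCountableTopology H := UniformSpace.secondCountable_of_separable H
  exact (measurable_iff_comap_le.2 (comap_le_past hst)).stronglyMeasurable.aestronglyMeasurable

/-- The coefficients of `Ψ` are the causal impulse response of `Z` up to the remote past: after
subtraction of the first `n` terms of `∑ k, Ψ_k ε (t - k)` only `ε s` with `s ≤ t - n` matter. -/
def HasResponse (P : Measure Ω) (ε Z : ℤ → Ω → H) (Ψ : PowerSeries (H →L[ℝ] H)) : Prop :=
  ∀ (n : ℕ) (t : ℤ), AEStronglyMeasurable[past ε (t - n)]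
    (fun ω => Z t ω - ∑ k ∈ Finset.range n, coeff k Ψ (ε (t - k) ω)) P

theorem sum_range_coeff_mul (T Θ : PowerSeries (H →L[ℝ] H)) (x : ℤ → H) (t : ℤ) {n N : ℕ}
    (hN : n ≤ N) : ∑ l ∈ Finset.range n, coeff l (T * Θ) (x (t - l)) =
      ∑ k ∈ Finset.range N, coeff k T
        (∑ m ∈ Finset.range (n - k), coeff m Θ (x (t - k - m))) := by
  have h1 : ∀ l ∈ Finset.range n, coeff l (T * Θ) (x (t - l)) =
      ∑ k ∈ Finset.range (l + 1), coeff k T (coeff (l - k) Θ (x (t - k - (l - k : ℕ)))) := by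
    intro l _
    rw [coeff_mul, Finset.Nat.sum_antidiagonal_eq_sum_range_succ
      (fun a b => coeff a T * coeff b Θ), sum_apply]
    refine Finset.sum_congr rfl fun k hk => ?_
    have : t - k - (l - k : ℕ) = t - l := by
      have := Finset.mem_range_succ_iff.1 hk
      omega
    rw [this]
    rfl
  rw [Finset.sum_congr rfl h1, Finset.sum_range_diag_flip n
    fun k m => coeff k T (coeff m Θ (x (t - k - m)))]
  simp only [map_sum]
  refine Finset.sum_subset (Finset.range_mono hN) fun k _ hk => ?_
  rw [Nat.sub_eq_zero_of_le (by simpa using hk)]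
  simp

/-- If `T` has leading coefficient one and `∑ k, T_k Z (t - k)` converges to `W t` in `L²` for a
causal process `Z`, the response of `Z` is the formal solution `Θ` of `T Θ = Ψ`, where `Ψ` is the
response of `W`. The recursion for `Θ` is triangular, so no convergence is needed. -/
theorem HasResponse.of_filter (hε : ∀ t, Measurable (ε t)) {Z W : ℤ → Ω → H}
    {T Ψ Θ : PowerSeries (H →L[ℝ] H)} (hT : coeff 0 T = 1) (hΘ : T * Θ = Ψ)
    (hZ : ∀ t, AEStronglyMeasurable[past ε t] (Z t) P) (hW : HasResponse P ε W Ψ)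
    (hlim : ∀ t : ℤ, Tendsto (fun N : ℕ => eLpNorm
      (fun ω => ∑ k ∈ Finset.range N, coeff k T (Z (t - k) ω) - W t ω) 2 P) atTop (𝓝 0)) :
    HasResponse P ε Z Θ := by
  intro n
  induction n using Nat.strong_induction_on with
  | _ n ih =>
  rcases n with - | n
  · intro t
    rw [Nat.cast_zero, sub_zero]
    simpa using hZ t
  intro t
  set D : ℕ → Ω → H := fun k ω => coeff k T (Z (t - k) ω -
    ∑ m ∈ Finset.range (n + 1 - k), coeff m Θ (ε (t - k - m) ω)) with hD
  have hDm : ∀ k, 1 ≤ k → AEStronglyMeasurable[past ε (t - (n + 1 : ℕ))] (D k) P := by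
    intro k hk
    refine (ContinuousLinearMap.continuous _).comp_aestronglyMeasurable ?_
    exact (ih (n + 1 - k) (by omega) (t - k)).mono (past_mono (by omega))
  have hid : ∀ (N : ℕ) (ω : Ω), ∑ k ∈ Finset.range (n + 1 + N), coeff k T (Z (t - k) ω) -
      ∑ l ∈ Finset.range (n + 1), coeff l Ψ (ε (t - l) ω) =
      D 0 ω + ∑ k ∈ Finset.range (n + N), D (k + 1) ω := by
    intro N ω
    rw [← hΘ, sum_range_coeff_mul T Θ (fun s => ε s ω) t (Nat.le_add_right (n + 1) N),
      ← Finset.sum_sub_distrib, add_right_comm n 1 N, Finset.sum_range_succ', add_comm (D 0 ω)]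
    simp only [hD, map_sub, Nat.cast_add, Nat.cast_one, Nat.cast_zero]
  have hD0 : (fun ω => Z t ω - ∑ k ∈ Finset.range (n + 1), coeff k Θ (ε (t - k) ω)) = D 0 := by
    ext ω
    simp only [hD, hT]
    simp
  rw [hD0]
  have hpl := past_le hε (t - (n + 1 : ℕ))
  refine aestronglyMeasurable_of_tendsto_eLpNorm (f := fun N ω =>
    (W t ω - ∑ l ∈ Finset.range (n + 1), coeff l Ψ (ε (t - l) ω)) -
      ∑ k ∈ Finset.range (n + N), D (k + 1) ω) hpl
    (fun N => (hW (n + 1) t).sub (aestronglyMeasurable_fun_sum _ fun k _ => hDm _ (by omega)))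
    ?_ ?_
  · rw [← hD0]
    refine ((hZ t).mono (past_le hε t)).sub (aestronglyMeasurable_fun_sum _ fun k _ => ?_)
    exact (ContinuousLinearMap.continuous _).comp_aestronglyMeasurable
      ((aestronglyMeasurable_noise_past le_rfl).mono (past_le hε _))
  · have h := (hlim t).comp (tendsto_add_atTop_nat (n + 1))
    refine h.congr fun N => ?_
    rw [← eLpNorm_neg]
    refine congrArg (fun f => eLpNorm f 2 P) ?_
    ext ω
    simp only [Pi.neg_apply, Pi.sub_apply]
    have h2 := hid N ω
    rw [add_comm N (n + 1)]
    rw [sub_eq_iff_eq_add] at h2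
    rw [h2]
    abel

theorem sum_range_coeff_lagSeries {p : ℕ} (A : Fin p → H →L[ℝ] H) (x : ℕ → H) (n : ℕ) :
    ∑ k ∈ Finset.range n, coeff k (lagSeries A) (x k) =
      ∑ j : Fin p, if (j : ℕ) + 1 < n then A j (x (j + 1)) else 0 := by
  have h1 : ∀ k, coeff k (lagSeries A) (x k) =
      ∑ j : Fin p, if k = (j : ℕ) + 1 then A j (x k) else 0 := by
    intro k
    rw [coeff_lagSeries, sum_apply]
    refine Finset.sum_congr rfl fun j _ => ?_
    split_ifs <;> rfl
  simp only [h1]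
  rw [Finset.sum_comm]
  refine Finset.sum_congr rfl fun j _ => ?_
  rw [Finset.sum_ite_eq' (Finset.range n) ((j : ℕ) + 1) fun k => A j (x k)]
  simp

theorem sum_range_coeff_one (x : ℕ → H) (n : ℕ) :
    ∑ k ∈ Finset.range n, coeff k (1 : PowerSeries (H →L[ℝ] H)) (x k) =
      if 0 < n then x 0 else 0 := by
  have h1 : ∀ k, coeff k (1 : PowerSeries (H →L[ℝ] H)) (x k) = if k = 0 then x k else 0 := by
    intro k
    rw [coeff_one]
    split_ifs <;> rfl
  simp only [h1]
  rw [Finset.sum_ite_eq' (Finset.range n) 0 x]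
  simp

theorem hasResponse_movingAverage {q : ℕ} (B : Fin q → H →L[ℝ] H) :
    HasResponse P ε (fun t ω => ε t ω + ∑ j : Fin q, B j (ε (t - (j + 1 : ℕ)) ω))
      (1 + lagSeries B) := by
  intro n t
  have h : (fun ω => (ε t ω + ∑ j : Fin q, B j (ε (t - (j + 1 : ℕ)) ω)) -
      ∑ k ∈ Finset.range n, coeff k (1 + lagSeries B : PowerSeries (H →L[ℝ] H)) (ε (t - k) ω)) =
      fun ω => (if 0 < n then 0 else ε t ω) +
        ∑ j : Fin q, if (j : ℕ) + 1 < n then 0 else B j (ε (t - (j + 1 : ℕ)) ω) := by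
    ext ω
    simp only [map_add, add_apply, Finset.sum_add_distrib]
    rw [sum_range_coeff_one (fun k => ε (t - k) ω), sum_range_coeff_lagSeries B
      (fun k => ε (t - k) ω), add_sub_add_comm, ← Finset.sum_sub_distrib]
    congr 1
    · split_ifs <;> simp
    · refine Finset.sum_congr rfl fun j _ => ?_
      split_ifs <;> simp
  rw [h]
  refine AEStronglyMeasurable.add ?_ (aestronglyMeasurable_fun_sum _ fun j _ => ?_)
  · split_ifs with h0
    · exact aestronglyMeasurable_const
    · exact aestronglyMeasurable_noise_past (by omega)
  · split_ifs with h0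
    · exact aestronglyMeasurable_const
    · exact (ContinuousLinearMap.continuous _).comp_aestronglyMeasurable
        (aestronglyMeasurable_noise_past (by omega))

theorem IsFARMA.hasResponse (hε : ∀ t, Measurable (ε t)) {p q : ℕ} {A : Fin p → H →L[ℝ] H}
    {B : Fin q → H →L[ℝ] H} {X : ℤ → Ω → H} (hX : IsFARMA P A B ε X) :
    HasResponse P ε X (farmaSeries A B) := by
  refine HasResponse.of_filter hε (T := 1 - lagSeries A) (Ψ := 1 + lagSeries B) ?_ ?_ hX.causal
    (hasResponse_movingAverage B) fun t => ?_
  · rw [coeff_zero_eq_constantCoeff_apply]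
    simp [constantCoeff_lagSeries]
  · rw [farmaSeries, ← mul_assoc, mul_arInverse, one_mul]
  · refine tendsto_const_nhds.congr' ?_
    filter_upwards [eventually_gt_atTop p] with N hN
    rw [eq_comm, eLpNorm_congr_ae (g := 0), eLpNorm_zero]
    filter_upwards [hX.equation t] with ω hω
    simp only [map_sub, sub_apply, Finset.sum_sub_distrib]
    rw [sum_range_coeff_one (fun k => X (t - k) ω), sum_range_coeff_lagSeries A
      (fun k => X (t - k) ω), if_pos (by omega)]
    have h1 : ∀ j : Fin p, (if (j : ℕ) + 1 < N then A j (X (t - (j + 1 : ℕ)) ω) else 0) =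
        A j (X (t - (j + 1 : ℕ)) ω) := fun j => if_pos (by omega)
    simp only [h1, Nat.cast_zero, sub_zero, hω, Pi.zero_apply]
    abel

/-- The power series of `(1 - z) ^ d` with scalar operators as coefficients. -/
def fracSeries (d : ℝ) : PowerSeries (H →L[ℝ] H) :=
  PowerSeries.map (algebraMap ℝ (H →L[ℝ] H)) (rescale (-1) (binomialSeries ℝ d))

theorem coeff_fracSeries (d : ℝ) (k : ℕ) :
    coeff k (fracSeries (H := H) d) = fracCoeff d k • 1 := by
  simp [fracSeries, fracCoeff, coeff_rescale, Algebra.algebraMap_eq_smul_one]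

theorem fracSeries_mul_neg (d : ℝ) :
    fracSeries (H := H) d * fracSeries (-d) = 1 := by
  rw [fracSeries, fracSeries, ← _root_.map_mul, ← _root_.map_mul, ← binomialSeries_add,
    add_neg_cancel, binomialSeries_zero, _root_.map_one, _root_.map_one]

/-- The power series `(1 - z) ^ (-d) 𝓐(z)⁻¹ 𝓑(z)` of the causal FARFIMA filter. -/
def farfimaSeries {p q : ℕ} (A : Fin p → H →L[ℝ] H) (d : ℝ) (B : Fin q → H →L[ℝ] H) :
    PowerSeries (H →L[ℝ] H) :=
  fracSeries (-d) * farmaSeries A B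

theorem IsFARFIMA.hasResponse (hε : ∀ t, Measurable (ε t)) {p q : ℕ} {A : Fin p → H →L[ℝ] H}
    {d : ℝ} {B : Fin q → H →L[ℝ] H} {Y : ℤ → Ω → H} (hY : IsFARFIMA P A d B ε Y) :
    HasResponse P ε Y (farfimaSeries A d B) := by
  obtain ⟨X, hX, hlim⟩ := hY.equation
  refine HasResponse.of_filter hε (T := fracSeries d) (Ψ := farmaSeries A B) ?_ ?_ hY.causal
    (hX.hasResponse hε) fun t => ?_
  · rw [coeff_fracSeries]
    simp [fracCoeff]
  · rw [farfimaSeries, ← mul_assoc, fracSeries_mul_neg, one_mul]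
  · simpa only [coeff_fracSeries, smul_apply, one_apply_eq_self] using hlim t

theorem zeroExtend_coeff_farfimaSeries {p q : ℕ} (A : Fin p → H →L[ℝ] H) (d : ℝ)
    (B : Fin q → H →L[ℝ] H) (k : ℤ) :
    filterCoeff (zeroExtend (fracCoeff (-d))) (fun n => coeff n (farmaSeries A B)) k =
      zeroExtend (fun n => coeff n (farfimaSeries A d B)) k := by
  unfold filterCoeff
  rcases lt_or_ge k 0 with hk | hk
  · rw [zeroExtend_of_neg _ hk]
    refine (tsum_congr fun i => ?_).trans tsum_zero
    rw [zeroExtend_of_neg _ (by omega), zero_smul]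
  · lift k to ℕ using hk
    rw [zeroExtend_natCast, tsum_eq_sum (s := Finset.range (k + 1)), farfimaSeries, coeff_mul,
      Finset.Nat.sum_antidiagonal_eq_sum_range_succ
        (fun a b => coeff a (fracSeries (-d)) * coeff b (farmaSeries A B)), Nat.succ_eq_add_one,
      ← Finset.sum_range_reflect]
    · refine Finset.sum_congr rfl fun i hi => ?_
      have hi' := Finset.mem_range_succ_iff.1 hi
      have h1 : k + 1 - 1 - i = k - i := by omega
      have h2 : (k : ℤ) - ((k - i : ℕ) : ℤ) = i := by omega
      rw [h1, h2, zeroExtend_natCast, coeff_fracSeries, smul_mul_assoc, one_mul]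
    · intro i hi
      rw [zeroExtend_of_neg _ (by simp at hi; omega), zero_smul]

end Inversion

/-! ### Covariances of a process with a given response -/

/-- A sequence in a Hilbert space whose increments are orthogonal to its later members converges:
the squared norms decrease by the squared norms of the increments. -/
theorem exists_tendsto_of_inner_sub_eq_zero {E : Type*} [NormedAddCommGroup E]
    [InnerProductSpace ℝ E] [CompleteSpace E] {r : ℕ → E}
    (h : ∀ n m, n ≤ m → inner ℝ (r n - r m) (r m) = 0) : ∃ x, Tendsto r atTop (𝓝 x) := by
  have hpyth : ∀ n m, n ≤ m → ‖r n‖ ^ 2 = ‖r n - r m‖ ^ 2 + ‖r m‖ ^ 2 := by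
    intro n m hnm
    have h1 := norm_add_sq_real (r n - r m) (r m)
    rw [sub_add_cancel, h n m hnm] at h1
    linarith
  have hanti : Antitone fun n => ‖r n‖ ^ 2 := fun n m hnm => by
    have := hpyth n m hnm
    simp only
    nlinarith [sq_nonneg ‖r n - r m‖]
  have hlim := tendsto_atTop_ciInf hanti ⟨0, by rintro _ ⟨n, rfl⟩; positivity⟩
  refine cauchySeq_tendsto_of_complete (Metric.cauchySeq_iff'.2 fun δ hδ => ?_)
  obtain ⟨N, hN⟩ := (Metric.cauchySeq_iff'.1 hlim.cauchySeq) (δ ^ 2) (by positivity)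
  refine ⟨N, fun n hn => ?_⟩
  have h1 := hN n hn
  have h2 := hpyth N n hn
  rw [Real.dist_eq, abs_sub_comm, h2, add_sub_cancel_right, abs_of_nonneg (sq_nonneg _)] at h1
  rw [dist_eq_norm, norm_sub_rev]
  exact (pow_lt_pow_iff_left₀ (norm_nonneg _) hδ.le two_ne_zero).1 h1

theorem integrable_mul_of_memLp {Ω : Type*} [MeasurableSpace Ω] {P : Measure Ω} {f g : Ω → ℝ}
    (hf : MemLp f 2 P) (hg : MemLp g 2 P) : Integrable (fun ω => f ω * g ω) P :=
  hf.integrable_mul hg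

theorem inner_toLp {Ω : Type*} [MeasurableSpace Ω] {P : Measure Ω} {f g : Ω → ℝ}
    (hf : MemLp f 2 P) (hg : MemLp g 2 P) :
    inner ℝ (hf.toLp f) (hg.toLp g) = ∫ ω, f ω * g ω ∂P := by
  rw [L2.inner_def]
  refine integral_congr_ae ?_
  filter_upwards [hf.coeFn_toLp, hg.coeFn_toLp] with ω h1 h2
  rw [h1, h2]
  simp [mul_comm]

section Covariance

open PowerSeries

variable {Ω : Type*} [MeasurableSpace Ω] {H : Type*} [NormedAddCommGroup H]
  [InnerProductSpace ℝ H] [CompleteSpace H] {P : Measure Ω} [IsProbabilityMeasure P]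

theorem integrable_rankOne {Y Z : Ω → H} (hY : MemLp Y 2 P) (hZ : MemLp Z 2 P) :
    Integrable (fun ω => InnerProductSpace.rankOne ℝ (Y ω) (Z ω)) P := by
  have hm : AEStronglyMeasurable (fun ω => InnerProductSpace.rankOne ℝ (Y ω) (Z ω)) P := by
    have h := (ContinuousLinearMap.smulRightL ℝ H H).aestronglyMeasurable_comp₂
      ((innerSL ℝ).continuous.comp_aestronglyMeasurable hZ.1) hY.1
    exact h.congr (Eventually.of_forall fun ω => (InnerProductSpace.rankOne_def _ _).symm)
  refine (hY.norm.integrable_mul hZ.norm).mono' hm (Eventually.of_forall fun ω => ?_)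
  rw [InnerProductSpace.norm_rankOne]
  rfl

theorem inner_crossCov {Y Z : Ω → H} (hY : MemLp Y 2 P) (hZ : MemLp Z 2 P)
    (hY0 : ∫ ω, Y ω ∂P = 0) (hZ0 : ∫ ω, Z ω ∂P = 0) (u v : H) :
    inner ℝ u (crossCov P Y Z v) = ∫ ω, inner ℝ u (Y ω) * inner ℝ v (Z ω) ∂P := by
  unfold crossCov
  simp only [hY0, hZ0, sub_zero]
  rw [ContinuousLinearMap.integral_apply (integrable_rankOne hY hZ),
    ← integral_inner ((integrable_rankOne hY hZ).apply_continuousLinearMap v)]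
  refine integral_congr_ae (Eventually.of_forall fun ω => ?_)
  simp only [InnerProductSpace.rankOne_apply, inner_smul_right, real_inner_comm v]
  ring

variable [TopologicalSpace.SeparableSpace H] [MeasurableSpace H] [BorelSpace H] {ε : ℤ → Ω → H}

theorem IsNoise.memLp_all (hε : IsNoise P ε) (t : ℤ) : MemLp (ε t) 2 P :=
  (hε.identDistrib t).memLp_iff.2 hε.memLp

theorem IsNoise.mean_zero_all (hε : IsNoise P ε) (t : ℤ) : ∫ ω, ε t ω ∂P = 0 := by
  rw [(hε.identDistrib t).integral_eq, hε.mean_zero]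

/-- The noise at time `s` is uncorrelated with every variable of the strict past. -/
theorem IsNoise.integral_mul_inner_eq_zero (hε : IsNoise P ε) {r s : ℤ} (hrs : r < s)
    {f : Ω → ℝ} (hf : AEStronglyMeasurable[past ε r] f P) (w : H) :
    ∫ ω, f ω * inner ℝ w (ε s ω) ∂P = 0 := by
  have h1 : ∫ ω, f ω * inner ℝ w (ε s ω) ∂P = ∫ ω, (hf.mk f * fun ω => inner ℝ w (ε s ω)) ω ∂P := by
    refine integral_congr_ae ?_
    filter_upwards [hf.ae_eq_mk] with ω h
    rw [Pi.mul_apply, ← h]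
  have hm : Measurable fun x : H => inner ℝ w x := (continuous_const.inner continuous_id).measurable
  have hind : IndepFun (hf.mk f) (fun ω => inner ℝ w (ε s ω)) P := by
    rw [IndepFun_iff_Indep]
    refine indep_of_indep_of_le_left (indep_of_indep_of_le_right
      (indep_past_comap hε.measurable hε.indep hrs) ?_) ?_
    · exact measurable_iff_comap_le.1 (hm.comp (comap_measurable (ε s)))
    · exact measurable_iff_comap_le.1 hf.stronglyMeasurable_mk.measurable
  rw [h1, hind.integral_mul_eq_mul_integral
    (hf.stronglyMeasurable_mk.mono (past_le hε.measurable r)).aestronglyMeasurable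
    ((hε.memLp_all s).const_inner w).1, integral_inner ((hε.memLp_all s).integrable one_le_two),
    hε.mean_zero_all, inner_zero_right, mul_zero]

theorem IsNoise.integral_inner_mul_inner (hε : IsNoise P ε) (s t : ℤ) (u v : H) :
    ∫ ω, inner ℝ u (ε s ω) * inner ℝ v (ε t ω) ∂P =
      if s = t then inner ℝ u (crossCov P (ε 0) (ε 0) v) else 0 := by
  have hpast : ∀ (s : ℤ) (u : H), AEStronglyMeasurable[past ε s] (fun ω => inner ℝ u (ε s ω)) P :=
    fun s u => (continuous_const.inner continuous_id).comp_aestronglyMeasurable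
      (aestronglyMeasurable_noise_past le_rfl)
  split_ifs with h
  · subst h
    rw [inner_crossCov hε.memLp hε.memLp hε.mean_zero hε.mean_zero]
    have hm : Measurable fun x : H => inner ℝ u x * inner ℝ v x :=
      ((continuous_const.inner continuous_id).mul (continuous_const.inner continuous_id)).measurable
    exact ((hε.identDistrib s).comp hm).integral_eq
  · rcases lt_or_gt_of_ne h with h | h
    · exact hε.integral_mul_inner_eq_zero h (hpast s u) v
    · simp only [mul_comm (inner ℝ u _)]
      exact hε.integral_mul_inner_eq_zero h (hpast t v) u

variable {Y : ℤ → Ω → H} {Θ : PowerSeries (H →L[ℝ] H)}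

theorem memLp_remainder (hε : IsNoise P ε) (hY : ∀ t, MemLp (Y t) 2 P) (n : ℕ) (t : ℤ) :
    MemLp (fun ω => Y t ω - ∑ k ∈ Finset.range n, coeff k Θ (ε (t - k) ω)) 2 P :=
  (hY t).sub (memLp_finsetSum _ fun k _ => (coeff k Θ).comp_memLp' (hε.memLp_all _))

/-- The correlation of `Y` with the noise is read off from its response. -/
theorem HasResponse.integral_inner_mul_noise (hε : IsNoise P ε) (hY : ∀ t, MemLp (Y t) 2 P)
    (hΘ : HasResponse P ε Y Θ) (s t : ℤ) (u w : H) :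
    ∫ ω, inner ℝ u (Y t ω) * inner ℝ w (ε s ω) ∂P =
      inner ℝ u (zeroExtend (fun k => coeff k Θ) (t - s) (crossCov P (ε 0) (ε 0) w)) := by
  -- this many terms of the response leave a remainder measurable before time `s`
  set n := (t - s + 1).toNat with hn
  have hr := hΘ n t
  have hrem := memLp_remainder (Θ := Θ) hε hY n t
  have h0 : ∫ ω, inner ℝ u (Y t ω - ∑ k ∈ Finset.range n, coeff k Θ (ε (t - k) ω)) *
      inner ℝ w (ε s ω) ∂P = 0 :=
    hε.integral_mul_inner_eq_zero (r := t - n) (by omega)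
      ((continuous_const.inner continuous_id).comp_aestronglyMeasurable hr) w
  have hw := (hε.memLp_all s).const_inner (𝕜 := ℝ) w
  have hk : ∀ k : ℕ, MemLp (fun ω => inner ℝ u (coeff k Θ (ε (t - k) ω))) 2 P := fun k =>
    ((coeff k Θ).comp_memLp' (hε.memLp_all (t - k))).const_inner (𝕜 := ℝ) u
  have hsplit : ∀ ω, inner ℝ u (Y t ω) * inner ℝ w (ε s ω) =
      inner ℝ u (Y t ω - ∑ k ∈ Finset.range n, coeff k Θ (ε (t - k) ω)) * inner ℝ w (ε s ω) +
      ∑ k ∈ Finset.range n, inner ℝ u (coeff k Θ (ε (t - k) ω)) * inner ℝ w (ε s ω) := by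
    intro ω
    rw [← Finset.sum_mul, ← inner_sum, ← add_mul, ← inner_add_right, sub_add_cancel]
  simp only [hsplit]
  rw [integral_add (integrable_mul_of_memLp (hrem.const_inner u) hw)
    (integrable_finsetSum _ fun k _ => integrable_mul_of_memLp (hk k) hw), h0, zero_add,
    integral_finsetSum _ fun k _ => integrable_mul_of_memLp (hk k) hw]
  have hterm : ∀ k : ℕ, ∫ ω, inner ℝ u (coeff k Θ (ε (t - k) ω)) * inner ℝ w (ε s ω) ∂P =
      if t - k = s then inner ℝ u (coeff k Θ (crossCov P (ε 0) (ε 0) w)) else 0 := by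
    intro k
    simp only [← ContinuousLinearMap.adjoint_inner_left (coeff k Θ)]
    exact hε.integral_inner_mul_inner (t - k) s _ w
  simp only [hterm]
  rcases lt_or_ge (t - s) 0 with h | h
  · rw [zeroExtend_of_neg _ h, show n = 0 by omega]
    simp
  · obtain ⟨m, hm⟩ := Int.eq_ofNat_of_zero_le h
    rw [hm, zeroExtend_natCast, Finset.sum_eq_single m]
    · rw [if_pos (by omega)]
    · intro k _ hkm
      rw [if_neg (by omega)]
    · intro hmn
      exact absurd (Finset.mem_range.2 (by omega)) hmn

/-- The remainders after the first `n` terms of the response vanish in `L²`: they converge by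
orthogonality, and the limit lies in the remote past. -/
theorem HasResponse.tendsto_remainder (hε : IsNoise P ε) (hY : ∀ t, MemLp (Y t) 2 P)
    (hY0 : ∀ t, ∫ ω, Y t ω ∂P = 0) (hΘ : HasResponse P ε Y Θ) (t : ℤ) (u : H) :
    Tendsto (fun n => (((memLp_remainder (Θ := Θ) hε hY n t).const_inner (𝕜 := ℝ) u).toLp _ :
      Lp ℝ 2 P)) atTop (𝓝 0) := by
  set r : ℕ → Ω → ℝ := fun n ω =>
    inner ℝ u (Y t ω - ∑ k ∈ Finset.range n, coeff k Θ (ε (t - k) ω)) with hr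
  have hrL : ∀ n, MemLp (r n) 2 P := fun n =>
    (memLp_remainder (Θ := Θ) hε hY n t).const_inner (𝕜 := ℝ) u
  change Tendsto (fun n => (hrL n).toLp (r n)) atTop (𝓝 0)
  have hrm : ∀ n : ℕ, AEStronglyMeasurable[past ε (t - n)] (r n) P := fun n =>
    (continuous_const.inner continuous_id).comp_aestronglyMeasurable (hΘ n t)
  have horth : ∀ n m, n ≤ m → inner ℝ ((hrL n).toLp (r n) - (hrL m).toLp (r m))
      ((hrL m).toLp (r m)) = 0 := by
    intro n m hnm
    rw [← MemLp.toLp_sub, inner_toLp ((hrL n).sub (hrL m)) (hrL m)]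
    have hdiff : ∀ ω, (r n - r m) ω * r m ω =
        ∑ k ∈ Finset.Ico n m, r m ω * inner ℝ (ContinuousLinearMap.adjoint (coeff k Θ) u)
          (ε (t - k) ω) := by
      intro ω
      simp only [hr, Pi.sub_apply]
      rw [← Finset.mul_sum, mul_comm]
      congr 1
      simp only [ContinuousLinearMap.adjoint_inner_left]
      rw [← inner_sub_right, sub_sub_sub_cancel_left, ← inner_sum,
        Finset.sum_Ico_eq_sub _ hnm]
    simp only [hdiff]
    rw [integral_finsetSum _ fun k _ => integrable_mul_of_memLp (hrL m)
      ((hε.memLp_all _).const_inner (𝕜 := ℝ) _)]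
    refine Finset.sum_eq_zero fun k hk => ?_
    have hkm := (Finset.mem_Ico.1 hk).2
    exact hε.integral_mul_inner_eq_zero (r := t - m) (by omega) (hrm m) _
  obtain ⟨x, hx⟩ := exists_tendsto_of_inner_sub_eq_zero horth
  have hx2 : Tendsto (fun n => eLpNorm (r n - (x : Ω → ℝ)) 2 P) atTop (𝓝 0) := by
    have hx' := hx
    rw [← Lp.toLp_coeFn x (Lp.memLp x)] at hx'
    exact (Lp.tendsto_Lp_iff_tendsto_eLpNorm'' r hrL x (Lp.memLp x)).1 hx'
  have hxpast : ∀ n : ℕ, AEStronglyMeasurable[past ε (t - n)] x P := by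
    intro n
    refine aestronglyMeasurable_of_tendsto_eLpNorm (past_le hε.measurable _)
      (f := fun m => r (m + n)) (fun m => (hrm (m + n)).mono (past_mono (by omega)))
      (Lp.aestronglyMeasurable x) (hx2.comp (tendsto_add_atTop_nat n))
  have hmean : ∀ n, ∫ ω, r n ω ∂P = 0 := by
    intro n
    have hint : ∀ k : ℕ, Integrable (fun ω => coeff k Θ (ε (t - k) ω)) P := fun k =>
      ((coeff k Θ).comp_memLp' (hε.memLp_all (t - k))).integrable one_le_two
    rw [integral_inner ((memLp_remainder (Θ := Θ) hε hY n t).integrable one_le_two),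
      integral_sub ((hY t).integrable one_le_two) (integrable_finsetSum _ fun k _ => hint k), hY0,
      integral_finsetSum _ fun k _ => hint k]
    simp only [ContinuousLinearMap.integral_comp_comm _ ((hε.memLp_all _).integrable one_le_two),
      hε.mean_zero_all, map_zero]
    simp
  have hxmean : ∫ ω, x ω ∂P = 0 := by
    have h1 : Tendsto (fun n => ∫ ω, r n ω ∂P) atTop (𝓝 (∫ ω, x ω ∂P)) := by
      refine tendsto_integral_of_L1' _ (Lp.aestronglyMeasurable x)
        (Eventually.of_forall fun n => (hrL n).integrable one_le_two) ?_
      refine tendsto_of_tendsto_of_tendsto_of_le_of_le tendsto_const_nhds hx2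
        (fun _ => zero_le) fun n => ?_
      exact eLpNorm_le_eLpNorm_of_exponent_le one_le_two
        ((hrL n).1.sub (Lp.aestronglyMeasurable x))
    simp only [hmean] at h1
    exact (tendsto_nhds_unique tendsto_const_nhds h1).symm
  have hx0 := ae_eq_zero_of_forall_past hε.measurable hε.indep hxpast
    ((Lp.memLp x).integrable one_le_two) hxmean
  rwa [Lp.eq_zero_iff_ae_eq_zero.2 hx0] at hx

/-- Expanding only `Y t` in the noise, up to a remainder that vanishes in `L²`, and correlating with
`Y (t + h)` yields the covariance in the weak sense. -/
theorem HasResponse.tendsto_sum_covariance (hε : IsNoise P ε) (hY : ∀ t, MemLp (Y t) 2 P)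
    (hY0 : ∀ t, ∫ ω, Y t ω ∂P = 0) (hΘ : HasResponse P ε Y Θ) (h t : ℤ) (u v : H) :
    Tendsto (fun n => ∑ k ∈ Finset.range n, inner ℝ u
      ((zeroExtend (fun k => coeff k Θ) (k + h) * crossCov P (ε 0) (ε 0) *
        star (coeff k Θ)) v)) atTop (𝓝 (inner ℝ u (crossCov P (Y (t + h)) (Y t) v))) := by
  have hu := (hY (t + h)).const_inner (𝕜 := ℝ) u
  have hk : ∀ k : ℕ, MemLp (fun ω => inner ℝ (ContinuousLinearMap.adjoint (coeff k Θ) v)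
      (ε (t - k) ω)) 2 P := fun k => (hε.memLp_all _).const_inner (𝕜 := ℝ) _
  have hlim := (tendsto_const_nhds (x := hu.toLp _)).inner (𝕜 := ℝ)
    (hΘ.tendsto_remainder hε hY hY0 t v)
  rw [inner_zero_right] at hlim
  have hid : ∀ n : ℕ, inner ℝ u (crossCov P (Y (t + h)) (Y t) v) - inner ℝ (hu.toLp _)
      (((memLp_remainder (Θ := Θ) hε hY n t).const_inner (𝕜 := ℝ) v).toLp _) =
      ∑ k ∈ Finset.range n, inner ℝ u ((zeroExtend (fun k => coeff k Θ) (k + h) *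
        crossCov P (ε 0) (ε 0) * star (coeff k Θ)) v) := by
    intro n
    have hrem := (memLp_remainder (Θ := Θ) hε hY n t).const_inner (𝕜 := ℝ) v
    rw [inner_toLp, inner_crossCov (hY _) (hY _) (hY0 _) (hY0 _), sub_eq_iff_eq_add']
    have hsplit : ∀ ω, inner ℝ u (Y (t + h) ω) * inner ℝ v (Y t ω) =
        inner ℝ u (Y (t + h) ω) *
          inner ℝ v (Y t ω - ∑ k ∈ Finset.range n, coeff k Θ (ε (t - k) ω)) +
        ∑ k ∈ Finset.range n, inner ℝ u (Y (t + h) ω) *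
          inner ℝ (ContinuousLinearMap.adjoint (coeff k Θ) v) (ε (t - k) ω) := by
      intro ω
      simp only [ContinuousLinearMap.adjoint_inner_left]
      rw [← Finset.mul_sum, ← inner_sum, ← mul_add, ← inner_add_right, sub_add_cancel]
    simp only [hsplit]
    rw [integral_add (integrable_mul_of_memLp hu hrem)
      (integrable_finsetSum _ fun k _ => integrable_mul_of_memLp hu (hk k)),
      integral_finsetSum _ fun k _ => integrable_mul_of_memLp hu (hk k)]
    congr 1
    refine Finset.sum_congr rfl fun k _ => ?_
    rw [hΘ.integral_inner_mul_noise hε hY, show t + h - (t - k) = k + h by ring]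
    rfl
  have h2 := hlim.const_sub (inner ℝ u (crossCov P (Y (t + h)) (Y t) v))
  rw [sub_zero] at h2
  exact h2.congr hid

/-- The autocovariance operators of a process whose response is absolutely summable against the
innovation covariance. -/
theorem HasResponse.crossCov_eq_tsum (hε : IsNoise P ε) (hY : ∀ t, MemLp (Y t) 2 P)
    (hY0 : ∀ t, ∫ ω, Y t ω ∂P = 0) (hΘ : HasResponse P ε Y Θ) (h t : ℤ)
    (hs : Summable fun k : ℤ => zeroExtend (fun k => coeff k Θ) (k + h) *
      crossCov P (ε 0) (ε 0) * star (zeroExtend (fun k => coeff k Θ) k)) :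
    crossCov P (Y (t + h)) (Y t) = ∑' k : ℤ, zeroExtend (fun k => coeff k Θ) (k + h) *
      crossCov P (ε 0) (ε 0) * star (zeroExtend (fun k => coeff k Θ) k) := by
  have hsN : HasSum (fun k : ℕ => zeroExtend (fun k => coeff k Θ) (k + h) *
      crossCov P (ε 0) (ε 0) * star (coeff k Θ)) (∑' k : ℤ,
        zeroExtend (fun k => coeff k Θ) (k + h) * crossCov P (ε 0) (ε 0) *
          star (zeroExtend (fun k => coeff k Θ) k)) := by
    have h1 := hs.hasSum
    rw [← (Nat.cast_injective (R := ℤ)).hasSum_iff] at h1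
    · simpa [Function.comp_def] using h1
    · intro k hk
      rw [zeroExtend_of_neg _ (k := k), star_zero, mul_zero]
      by_contra! h0
      exact hk ⟨k.toNat, by simp [h0]⟩
  ext v
  refine ext_inner_left ℝ fun u => ?_
  refine tendsto_nhds_unique (hΘ.tendsto_sum_covariance hε hY hY0 h t u v) ?_
  have h2 := ((innerSL ℝ u).comp (ContinuousLinearMap.apply ℝ H v)).hasSum hsN
  exact h2.tendsto_sum_nat

end Covariance

/-! ### The complexified innovation covariance -/

section ComplexCovariance

variable {Ω : Type*} [MeasurableSpace Ω] {H : Type*} [NormedAddCommGroup H]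
  [InnerProductSpace ℝ H] [CompleteSpace H] {P : Measure Ω} [IsProbabilityMeasure P]

theorem Complexification.norm_mk_zero (x : H) : ‖mk x 0‖ = ‖x‖ := by
  have h := norm_sq (mk x 0)
  rw [re_mk, im_mk, norm_zero, zero_pow two_ne_zero, add_zero] at h
  exact (pow_left_inj₀ (norm_nonneg _) (norm_nonneg _) two_ne_zero).1 h

theorem Complexification.continuous_mk_zero : Continuous fun x : H => mk x 0 :=
  (WithLp.prod_continuous_toLp 2 H H).comp (continuous_id.prodMk continuous_const)

/-- The complexification of a real covariance operator is the covariance operator of the same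
random element, regarded as an element of the complexified space. -/
theorem Complexification.inner_map_crossCov {x : Ω → H} (hx : MemLp x 2 P)
    (hx0 : ∫ ω, x ω ∂P = 0) (u v : Complexification H) :
    inner ℂ u (map (crossCov P x x) v) =
      ∫ ω, inner ℂ u (mk (x ω) 0) * inner ℂ (mk (x ω) 0) v ∂P := by
  have hint : ∀ a b : H, Integrable (fun ω => inner ℝ a (x ω) * inner ℝ b (x ω)) P := fun a b =>
    integrable_mul_of_memLp (hx.const_inner a) (hx.const_inner b)
  have hpt : ∀ ω, inner ℂ u (mk (x ω) 0) * inner ℂ (mk (x ω) 0) v =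
      ((inner ℝ u.re (x ω) * inner ℝ v.re (x ω) + inner ℝ u.im (x ω) * inner ℝ v.im (x ω) : ℝ) :
        ℂ) +
      ((inner ℝ u.re (x ω) * inner ℝ v.im (x ω) - inner ℝ u.im (x ω) * inner ℝ v.re (x ω) : ℝ) :
        ℂ) * Complex.I := by
    intro ω
    rw [inner_eq, inner_eq]
    apply Complex.ext
    · simp [real_inner_comm (x ω)]
    · simp [real_inner_comm (x ω)]
      ring
  simp only [hpt]
  rw [integral_add (((hint _ _).add (hint _ _)).ofReal)
    ((((hint _ _).sub (hint _ _)).ofReal).mul_const _), integral_mul_const, integral_complex_ofReal,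
    integral_complex_ofReal, integral_add (hint _ _) (hint _ _),
    integral_sub (hint _ _) (hint _ _), inner_eq]
  simp only [← inner_crossCov hx hx hx0 hx0]
  apply Complex.ext <;> simp

theorem Complexification.traceNorm_map_crossCov_le {x : Ω → H} (hx : MemLp x 2 P)
    (hx0 : ∫ ω, x ω ∂P = 0) (C D : Complexification H →L[ℂ] Complexification H) :
    traceNorm (C * map (crossCov P x x) * ContinuousLinearMap.adjoint D) ≤
      ‖C‖ₑ * ‖D‖ₑ * ∫⁻ ω, ‖mk (x ω) 0‖ₑ ^ 2 ∂P :=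
  traceNorm_sandwich_le (continuous_mk_zero.comp_aestronglyMeasurable hx.1)
    (inner_map_crossCov hx hx0) C D

theorem Complexification.lintegral_mk_zero_ne_top {x : Ω → H} (hx : MemLp x 2 P) :
    ∫⁻ ω, ‖mk (x ω) 0‖ₑ ^ 2 ∂P ≠ ∞ := by
  have h := lintegral_rpow_enorm_lt_top_of_eLpNorm_lt_top two_ne_zero ENNReal.ofNat_ne_top hx.2
  refine ne_of_lt (lt_of_le_of_lt (lintegral_mono fun ω => ?_) h)
  rw [← ofReal_norm, norm_mk_zero, ofReal_norm]
  simp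

end ComplexCovariance

/-! ### The spectral density of a FARFIMA process -/

section SpectralDensity

variable {H : Type*} [NormedAddCommGroup H] [InnerProductSpace ℝ H] [CompleteSpace H]

/-- The FARFIMA spectral density operator `(2 sin (ω / 2)) ^ (-2d) (2π)⁻¹ Ψ(z) T Ψ(z)^*` at
`z = exp (-i ω)`, as a trace-class operator; `Ψ = 𝓐⁻¹ 𝓑` and `T` is the complexified innovation
covariance, whose sandwiches have trace norms controlled by `K`. -/
def farfimaDensity {p q : ℕ} (A : Fin p → H →L[ℝ] H) (d : ℝ) (B : Fin q → H →L[ℝ] H)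
    (T : Complexification H →L[ℂ] Complexification H) {K : ℝ≥0∞} (hK : K ≠ ∞)
    (hT : ∀ C D : Complexification H →L[ℂ] Complexification H,
      traceNorm (C * T * ContinuousLinearMap.adjoint D) ≤ ‖C‖ₑ * ‖D‖ₑ * K) (ω : ℝ) :
    TraceClass (Complexification H) :=
  (((2 * Real.sin (ω / 2)) ^ (-2 * d) : ℝ) : ℂ) • ((2 * Real.pi : ℝ) : ℂ)⁻¹ • sandwich T hK hT
    (symbol Complexification.mapRingHom (farmaSeries A B) (Complex.exp (-Complex.I * ω)))

theorem intervalIntegrable_farfima {d : ℝ} (hd : d < 1 / 2) :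
    IntervalIntegrable (fun ω => (2 * Real.sin (ω / 2)) ^ (-2 * d)) volume 0 (2 * Real.pi) := by
  rw [show -2 * d = 2 * -d by ring]
  exact intervalIntegrable_sin_rpow (by linarith)

theorem integral_sin_rpow_neg_mul_exp {d : ℝ} (hd : d < 1 / 2) (m : ℤ) :
    ∫ ω in (0 : ℝ)..(2 * Real.pi), (((2 * Real.sin (ω / 2)) ^ (-2 * d) : ℝ) : ℂ) *
        Complex.exp (Complex.I * m * ω) =
      (2 * Real.pi : ℝ) * (scalarAutocov (zeroExtend (fracCoeff (-d))) m : ℝ) := by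
  rw [show -2 * d = 2 * -d by ring]
  exact integral_sin_rpow_mul_exp (by linarith) m

theorem memLp_farfimaDensity {p q : ℕ} {A : Fin p → H →L[ℝ] H} (hA : StabilityCondition A)
    {d : ℝ} (hd : d < 1 / 2) (B : Fin q → H →L[ℝ] H)
    (T : Complexification H →L[ℂ] Complexification H) {K : ℝ≥0∞} (hK : K ≠ ∞)
    (hT : ∀ C D : Complexification H →L[ℂ] Complexification H,
      traceNorm (C * T * ContinuousLinearMap.adjoint D) ≤ ‖C‖ₑ * ‖D‖ₑ * K) :
    MemLp (farfimaDensity A d B T hK hT) 1 (volume.restrict (Set.Icc 0 (2 * Real.pi))) := by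
  have hsymbol := continuous_symbol (𝓐 := Complexification H →L[ℂ] Complexification H)
    Complexification.mapRingHom Complexification.norm_map_le
    (summable_norm_coeff_farmaSeries (summable_norm_coeff_arInverse hA) B)
  exact memLp_smul_continuous (intervalIntegrable_farfima hd)
    (((continuous_sandwich hK hT).comp hsymbol).const_smul ((2 * Real.pi : ℝ) : ℂ)⁻¹)

variable {Ω : Type*} [MeasurableSpace Ω] {P : Measure Ω} [IsProbabilityMeasure P]
  [TopologicalSpace.SeparableSpace H] [MeasurableSpace H] [BorelSpace H]

/-- The inversion formula for the autocovariance operators of a FARFIMA process. -/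
theorem IsFARFIMA.map_crossCov_eq_integral {p q : ℕ} {A : Fin p → H →L[ℝ] H}
    (hA : StabilityCondition A) {d : ℝ} (hd : d < 1 / 2) {B : Fin q → H →L[ℝ] H}
    {ε Y : ℤ → Ω → H} (hε : IsNoise P ε) (hY : IsFARFIMA P A d B ε Y) (t h : ℤ) :
    Complexification.map (crossCov P (Y (t + h)) (Y t)) =
      ∫ ω in (0 : ℝ)..(2 * Real.pi), Complex.exp (Complex.I * h * ω) •
        (((2 * Real.sin (ω / 2)) ^ (-2 * d) : ℝ) : ℂ) • ((2 * Real.pi : ℝ) : ℂ)⁻¹ •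
          (symbol Complexification.mapRingHom (farmaSeries A B) (Complex.exp (-Complex.I * ω)) *
            Complexification.map (crossCov P (ε 0) (ε 0)) * ContinuousLinearMap.adjoint
              (symbol Complexification.mapRingHom (farmaSeries A B)
                (Complex.exp (-Complex.I * ω)))) := by
  have ha : Summable fun k : ℤ => zeroExtend (fracCoeff (-d)) k ^ 2 :=
    summable_sq_zeroExtend_fracCoeff (by linarith)
  have hf := summable_norm_coeff_farmaSeries (summable_norm_coeff_arInverse hA) B
  have hs := (hasSum_filterCoeff_sandwich ha hf (crossCov P (ε 0) (ε 0)) h).summable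
  have hmap := map_tsum_filterCoeff_sandwich (𝓐 := Complexification H →L[ℂ] Complexification H)
    Complexification.mapRingHom Complexification.norm_map_le
    (fun T => (Complexification.adjoint_map T).symm) Complexification.map_smul_real ha
    (intervalIntegrable_farfima hd) (integral_sin_rpow_neg_mul_exp hd) hf
    (crossCov P (ε 0) (ε 0)) h
  simp only [zeroExtend_coeff_farfimaSeries] at hs hmap
  rw [(hY.hasResponse hε.measurable).crossCov_eq_tsum hε hY.memLp hY.mean_zero h t hs]
  exact hmap

end SpectralDensity

end FTS

end

theorem theorem4 {Ω : Type*} [MeasurableSpace Ω] (P : Measure Ω) [IsProbabilityMeasure P]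
    {H : Type*} [NormedAddCommGroup H] [InnerProductSpace ℝ H] [CompleteSpace H]
    [TopologicalSpace.SeparableSpace H] [MeasurableSpace H] [BorelSpace H]
    (p q : ℕ) (d : ℝ) (hd : d ∈ Set.Ioo (-1 / 2 : ℝ) (1 / 2))
    (A : Fin p → H →L[ℝ] H) (B : Fin q → H →L[ℝ] H) (hA : FTS.StabilityCondition A)
    (ε : ℤ → Ω → H) (hε : FTS.IsNoise P ε)
    (S : H →L[ℝ] H) (hS : S = FTS.crossCov P (ε 0) (ε 0))
    (Y : ℤ → Ω → H) (hY : FTS.IsFARFIMA P A d B ε Y) :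
    (∀ ω : ℝ, IsUnit (FTS.arPoly A (Complex.exp (-Complex.I * ω)))) ∧
    ∃ F : ℝ → FTS.TraceClass (FTS.Complexification H),
      FTS.IsWeakSpectralDensity P Y F ∧
      ∀ ω ∈ Set.Ioo (0 : ℝ) (2 * Real.pi),
        (F ω).toCLM = ((((2 * Real.sin (ω / 2)) ^ (-2 * d) : ℝ)) : ℂ) •
          FTS.farmaSpectralDensity A B S ω := by
  subst hS
  refine ⟨fun ω => FTS.isUnit_arPoly hA (FTS.norm_exp_neg_I_mul ω),
    FTS.farfimaDensity A d B (FTS.Complexification.map (FTS.crossCov P (ε 0) (ε 0)))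
      (FTS.Complexification.lintegral_mk_zero_ne_top hε.memLp)
      (FTS.Complexification.traceNorm_map_crossCov_le hε.memLp hε.mean_zero),
    ⟨FTS.memLp_farfimaDensity hA hd.2 B _ _ _, fun t h => ?_⟩, fun ω _ => ?_⟩
  · exact hY.map_crossCov_eq_integral hA hd.2 hε t h
  · rw [FTS.farmaSpectralDensity_eq hA]
    rfl
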